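/- **Setting.** Let $p,d_1,\dots,d_p$ be fixed and $r=\sum_{j=1}^p d_j$. Write $\beta\in\mathbb R^r$ as $\beta=(\beta_1,\dots,\beta_p)$ with $\beta_j\in\mathbb R^{d_j}$. Consider the linear model with $p$ groups of explanatory variables $$Y_i=\mathbb X_i^t\beta^0+\varepsilon_i,\qquad i=1,2,\dots,$$ with deterministic design vectors $\mathbb X_i\in\mathbb R^r$ and true parameter $\beta^0\in\mathbb R^r$. Let $\mathcal A=\{j:\beta^0_j\neq 0\}$ be the set of relevant groups and $r^0=\sum_{j\in\mathcal A}d_j$. For a vector $\beta$, respectively an $r\times r$ matrix $\Upsilon$, let $\beta_{\mathcal A}$, respectively $\Upsilon_{\mathcal A}$, be the subvector, respectively the submatrix, with the indices (row and column indices) belonging to the groups in $\mathcal A$. Fix $\tau\in(0,1)$ and $\gamma>0$, let $\rho_\tau(u)=u(\tau-1_{u<0})$, and let $\|\cdot\|$ be the Euclidean norm. For each $n$, let $\widetilde\beta_n$ be a quantile estimator, i.e. a measurable minimizer $$\widetilde\beta_n\in\arg\min_{\beta\in\mathbb R^r}\sum_{i=1}^n\rho_\tau(Y_i-\mathbb X_i^t\beta),$$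 and let $\widehat\beta^*_n$ be an adaptive group LASSO quantile estimator, i.e. a measurable minimizer $$\widehat\beta^*_n\in\arg\min_{\beta\in\mathbb R^r}\Big\{\sum_{i=1}^n\rho_\tau(Y_i-\mathbb X_i^t\beta)+\mu_n\sum_{j=1}^p\|\widetilde\beta_{n;j}\|^{-\gamma}\,\|\beta_j\|\Big\},$$ where $\mu_n\ge 0$ is the tuning parameter and a weight $\|\widetilde\beta_{n;j}\|^{-\gamma}$ with $\widetilde\beta_{n;j}=0$ is $+\infty$ (with $\infty\cdot 0=0$). **Assumptions.** (A1) $n^{-1}\max_{1\le i\le n}\mathbb X_i^t\mathbb X_i\to 0$ and $n^{-1}\sum_{i=1}^n\mathbb X_i\mathbb X_i^t\to\Upsilon$ as $n\to\infty$, with $\Upsilon$ an $r\times r$ positive definite matrix. (A2) The errors $(\varepsilon_i)$ are independent and identically distributed with distribution function $F$; in a neighbourhood of $0$ their law has a continuous positive density $f$; and $F(0)=\tau$. Moreover, for a set $B\subseteq\mathbb R$ with $0\in B$ and for every $e$ in the interior of $B$, with $\mathbf 1_r=(1,\dots,1)^t\in\mathbb R^r$, $$\lim_{n\to\infty}n^{-1}\sum_{i=1}^n\int_0^{\mathbb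 X_i^t\mathbf 1_r}\sqrt n\,\big[F(e+v/\sqrt n)-F(e)\big]\,dv=\tfrac12 f(e)\,\mathbf 1_r^t\Upsilon\mathbf 1_r .$$ (Tuning) As $n\to\infty$: $\mu_n\to\infty$, $\mu_n/\sqrt n\to 0$ and $n^{(\gamma-1)/2}\mu_n\to\infty$. **Theorem.** Under (A1), (A2) and (Tuning), the adaptive group LASSO quantile estimator of the relevant groups is asymptotically normal: $$\sqrt n\,(\widehat\beta^*_n-\beta^0)_{\mathcal A}\ \xrightarrow{\ \mathcal L\ }\ \mathcal N\big(0_{r^0},\ \tau(1-\tau)\,f(0)^{-2}\,\Upsilon_{\mathcal A}^{-1}\big)\qquad(n\to\infty).$$ -/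

import Mathlib

open MeasureTheory ProbabilityTheory Filter Topology

noncomputable section

namespace GroupLassoQuantile

/-- The coordinates of a parameter vector made of `p` groups, the `j`-th one of size `d j`. -/
abbrev Idx {p : ℕ} (d : Fin p → ℕ) : Type := (j : Fin p) × Fin (d j)

/-- `ℝ ^ r` with `r = ∑ j, d j`, split into groups, with the Euclidean norm. -/
abbrev Vec {p : ℕ} (d : Fin p → ℕ) : Type := EuclideanSpace ℝ (Idx d)

/-- The coordinates that belong to the groups in `A`. -/
abbrev IdxOn {p : ℕ} (d : Fin p → ℕ) (A : Finset (Fin p)) : Type := {a : Idx d // a.1 ∈ A}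

/-- The subvector `β_j` of the `j`-th group. -/
def group {p : ℕ} {d : Fin p → ℕ} (b : Vec d) (j : Fin p) : EuclideanSpace ℝ (Fin (d j)) :=
  WithLp.toLp 2 (fun k => b ⟨j, k⟩)

/-- The subvector `β_A` of the groups in `A`. -/
def restrictTo {p : ℕ} {d : Fin p → ℕ} (A : Finset (Fin p)) (b : Vec d) :
    EuclideanSpace ℝ (IdxOn d A) :=
  WithLp.toLp 2 (fun a => b a.1)

/-- The submatrix `M_A` with the row and column indices of the groups in `A`. -/
def submatrixOn {p : ℕ} {d : Fin p → ℕ} (A : Finset (Fin p)) (M : Matrix (Idx d) (Idx d) ℝ) :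
    Matrix (IdxOn d A) (IdxOn d A) ℝ :=
  M.submatrix Subtype.val Subtype.val

/-- The vector with all components equal to `1`. -/
def ones {p : ℕ} (d : Fin p → ℕ) : Vec d := WithLp.toLp 2 (fun _ => 1)

/-- The check function `ρ_τ(u) = u (τ - 1_{u < 0})`. -/
def checkLoss (τ u : ℝ) : ℝ := u * (τ - if u < 0 then 1 else 0)

/-- The quantile process `∑_{i ≤ n} ρ_τ(y_i - x_iᵗ b)` of the first `n` observations. -/
def quantileProcess {p : ℕ} {d : Fin p → ℕ} (τ : ℝ) (X : ℕ → Vec d) (y : ℕ → ℝ) (n : ℕ)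
    (b : Vec d) : ℝ :=
  ∑ i ∈ Finset.range n, checkLoss τ (y i - inner ℝ (X i) b)

/-- The adaptive weight `‖b_j‖ ^ (-γ)`. It is `∞` when `b_j = 0`. -/
def weight {p : ℕ} {d : Fin p → ℕ} (γ : ℝ) (b : Vec d) (j : Fin p) : ENNReal :=
  ‖group b j‖ₑ ^ (-γ)

/-- The quantile process with the adaptive group LASSO penalty
`m ∑_j ‖bInit_j‖ ^ (-γ) ‖b_j‖`, as a function of `b` with values in `[0, ∞]`
(for `τ ∈ [0, 1]` the quantile process is nonnegative). A group with an infinite weight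
contributes `∞ * 0 = 0` if `b_j = 0`, and `∞` otherwise (for `0 < m`). -/
def penalizedProcess {p : ℕ} {d : Fin p → ℕ} (τ γ m : ℝ) (X : ℕ → Vec d) (y : ℕ → ℝ) (n : ℕ)
    (bInit b : Vec d) : ENNReal :=
  ENNReal.ofReal (quantileProcess τ X y n b)
    + ENNReal.ofReal m * ∑ j, weight γ bInit j * ‖group b j‖ₑ

/-- The assumption on the (deterministic) design. -/
structure DesignAssumption {p : ℕ} {d : Fin p → ℕ} (X : ℕ → Vec d)
    (Υ : Matrix (Idx d) (Idx d) ℝ) : Prop where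
  max_tendsto : Tendsto (fun n : ℕ => (n : ℝ)⁻¹ * ⨆ i : Fin n, inner ℝ (X i) (X i)) atTop (𝓝 0)
  gram_tendsto : Tendsto
    (fun n : ℕ => (n : ℝ)⁻¹ • ∑ i ∈ Finset.range n, Matrix.vecMulVec (X i).ofLp (X i).ofLp)
    atTop (𝓝 Υ)
  posDef : Υ.PosDef

/-- The assumption on the errors: they are i.i.d. with law `ν`, whose distribution function is
`F = cdf ν`; in a neighbourhood of `0` the law has the continuous and positive density `f`; the
`τ`-th quantile is `0`; and the limit relation between `F`, the design and `f` holds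
at every interior point `e` of a set `B` of reals that contains `0`. -/
structure ErrorAssumption {Ω : Type*} [MeasurableSpace Ω] (P : Measure Ω) {p : ℕ}
    {d : Fin p → ℕ} (τ : ℝ) (X : ℕ → Vec d) (Υ : Matrix (Idx d) (Idx d) ℝ) (ε : ℕ → Ω → ℝ)
    (ν : Measure ℝ) (f : ℝ → ℝ) (B : Set ℝ) : Prop where
  indep : iIndepFun ε P
  law : ∀ i, HasLaw (ε i) ν P
  density : ∃ U : Set ℝ, IsOpen U ∧ 0 ∈ U ∧ ContinuousOn f U ∧ (∀ x ∈ U, 0 < f x) ∧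
    ν.restrict U = (volume.restrict U).withDensity (fun x => ENNReal.ofReal (f x))
  quantile : cdf ν 0 = τ
  zero_mem : (0 : ℝ) ∈ B
  limit : ∀ e ∈ interior B, Tendsto
    (fun n : ℕ => (n : ℝ)⁻¹ * ∑ i ∈ Finset.range n,
      ∫ v in (0 : ℝ)..(inner ℝ (X i) (ones d)), √(n : ℝ) * (cdf ν (e + v / √(n : ℝ)) - cdf ν e))
    atTop (𝓝 (1 / 2 * f e * ((ones d).ofLp ⬝ᵥ (Matrix.mulVec Υ (ones d).ofLp))))

/-- The conditions on the tuning parameters. -/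
structure TuningCondition (μ : ℕ → ℝ) (γ : ℝ) : Prop where
  tendsto_atTop : Tendsto μ atTop atTop
  div_sqrt_tendsto : Tendsto (fun n : ℕ => μ n / √(n : ℝ)) atTop (𝓝 0)
  rpow_mul_tendsto : Tendsto (fun n : ℕ => (n : ℝ) ^ ((γ - 1) / 2) * μ n) atTop atTop

end GroupLassoQuantile

end

/-! Set `u = √n (β - β0)`. Knight's identity (`checkLoss_sub`) turns the quantile process, up to a
constant, into `R_n(u) - ⟨W_n, u⟩`. Here `W_n` is the normalized sum of scores and `R_n` is a convex
sum of remainders. Each summand of `R_n` only sees errors in a shrinking neighbourhood of `0`, so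
the density gives `R_n(u) → f(0)/2 · uᵗΥu` in probability for fixed `u`. Convexity makes this
uniform on balls (`exists_finset_forall_convexOn_of_isCompact`). The scores take two values and have
mean zero, and characteristic functions show that `W_n` is asymptotically `N(0, τ(1-τ)Υ)`, hence
tight.

The unpenalized estimator is therefore within `K/√n` of `β0` with high probability. In the scale of
`u`, the penalty then has slope at most of order `μ_n/√n → 0` on a relevant group, and at least
`K^(-γ) n^((γ-1)/2) μ_n → ∞` on an irrelevant one.

Let `a` be the extension by zero of `(f(0) Υ_A)⁻¹ (W_n)_A`. At `a` the gradient of the limiting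
quadratic vanishes on `A`; off `A` it is bounded, so the penalty's kink at zero absorbs it
(`penalty_sub_add_inner_ge`). Thus `a` is nearly optimal for the penalized problem, and strong
convexity of the quadratic forces the minimizer to lie near `a` (`norm_sub_lt_of_quadratic_approx`,
`exists_forall_norm_sub_oracleMap_lt`). No separate proof that irrelevant groups are estimated by
zero is needed. A Slutsky argument transfers the Gaussian limit from `oracleMap` applied to `W_n` to
the estimator. -/

namespace GroupLassoQuantile

/-! ### Knight's identity and the remainder function -/

section

/-- The remainder in Knight's identity for the check function. -/
noncomputable def knightRemainder (x h : ℝ) : ℝ := if x < 0 then max (x - h) 0 else max (h - x) 0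

/-- The derivative `τ - 1_{x < 0}` of the check function. -/
noncomputable def score (τ x : ℝ) : ℝ := τ - if x < 0 then 1 else 0

/-- Knight's identity: the remainder is nonzero only when `x` and `x - h` fall on different sides of
the kink. -/
lemma checkLoss_sub (τ x h : ℝ) :
    checkLoss τ (x - h) = checkLoss τ x - h * score τ x + knightRemainder x h := by
  unfold checkLoss score knightRemainder
  rcases lt_or_ge x 0 with hx | hx <;> rcases lt_or_ge (x - h) 0 with hh | hh
  · rw [if_pos hx, if_pos hh, if_pos hx, max_eq_right hh.le]; ring
  · rw [if_pos hx, if_neg hh.not_gt, if_pos hx, max_eq_left hh]; ring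
  · rw [if_neg hx.not_gt, if_pos hh, if_neg hx.not_gt, max_eq_left (by linarith)]; ring
  · rw [if_neg hx.not_gt, if_neg hh.not_gt, if_neg hx.not_gt, max_eq_right (by linarith)]; ring

lemma checkLoss_nonneg {τ : ℝ} (hτ : τ ∈ Set.Ioo (0 : ℝ) 1) (x : ℝ) : 0 ≤ checkLoss τ x := by
  unfold checkLoss
  split_ifs with h
  · exact mul_nonneg_of_nonpos_of_nonpos h.le (by linarith [hτ.2])
  · exact mul_nonneg (not_lt.1 h) (by linarith [hτ.1])

lemma knightRemainder_nonneg (x h : ℝ) : 0 ≤ knightRemainder x h := by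
  unfold knightRemainder
  split_ifs <;> exact le_max_right _ _

lemma knightRemainder_le_abs (x h : ℝ) : knightRemainder x h ≤ |h| := by
  unfold knightRemainder
  split_ifs with hx
  · exact max_le (by linarith [neg_le_abs h]) (abs_nonneg h)
  · exact max_le (by linarith [le_abs_self h]) (abs_nonneg h)

/-- A shift no larger than `|x|` cannot carry `x` strictly across the kink. This localization is
what makes a density near `0` sufficient. -/
lemma knightRemainder_eq_zero {x h : ℝ} (hx : |h| ≤ |x|) : knightRemainder x h = 0 := by
  unfold knightRemainder
  split_ifs with h0
  · rw [abs_of_neg h0] at hx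
    exact max_eq_right (by linarith [neg_le_abs h])
  · rw [abs_of_nonneg (not_lt.1 h0)] at hx
    exact max_eq_right (by linarith [le_abs_self h])

lemma convexOn_knightRemainder (x : ℝ) : ConvexOn ℝ Set.univ (knightRemainder x) := by
  have h1 : ConvexOn ℝ Set.univ (fun h : ℝ => max (x - h) 0) :=
    ((convexOn_const x convex_univ).sub (concaveOn_id convex_univ)).sup
      (convexOn_const 0 convex_univ)
  have h2 : ConvexOn ℝ Set.univ (fun h : ℝ => max (h - x) 0) :=
    ((convexOn_id convex_univ).sub (concaveOn_const x convex_univ)).sup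
      (convexOn_const 0 convex_univ)
  by_cases hx : x < 0
  · convert h1 using 2; simp [knightRemainder, hx]
  · convert h2 using 2; simp [knightRemainder, hx]

lemma measurable_knightRemainder (h : ℝ) : Measurable (fun x => knightRemainder x h) := by
  unfold knightRemainder
  exact Measurable.ite measurableSet_Iio (by fun_prop) (by fun_prop)

lemma measurable_score (τ : ℝ) : Measurable (score τ) := by
  unfold score
  exact measurable_const.sub (Measurable.ite measurableSet_Iio measurable_const measurable_const)

/-! ### From pointwise to uniform approximation of convex functions -/

section Convex

variable {E : Type*} [NormedAddCommGroup E] [NormedSpace ℝ E]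

/-- A convex function close to a continuous function at finitely many suitable points
is close to it near a given point. -/
lemma exists_finset_forall_convexOn_near [FiniteDimensional ℝ E] {q : E → ℝ} (hq : Continuous q)
    (x : E) {η : ℝ} (hη : 0 < η) :
    ∃ S : Finset E, ∃ δ > 0, ∃ U ∈ 𝓝 x, ∀ g : E → ℝ, ConvexOn ℝ Set.univ g →
      (∀ s ∈ S, |g s - q s| ≤ δ) → ∀ y ∈ U, |g y - q y| ≤ η := by
  classical
  have hV : {y | |q y - q x| < η / 8} ∈ 𝓝 x := by
    have := hq.tendsto x (Metric.ball_mem_nhds (q x) (by positivity : 0 < η / 8))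
    simpa [Real.dist_eq, Set.preimage, Metric.ball] using this
  -- A small simplex around `x`: a convex function is bounded above on it by its values at the
  -- vertices.
  obtain ⟨b, hb, hbV⟩ := exists_mem_interior_convexHull_affineBasis hV
  set T : Set E := Set.range b
  have hT : T.Finite := Set.finite_range b
  have hN : convexHull ℝ T ∈ 𝓝 x := mem_interior_iff_mem_nhds.1 hb
  -- Requiring the reflection of `y` through `x` to lie in the simplex too turns the upper bound
  -- there into a lower bound at `y`, by midpoint convexity.
  have hN' : {y | (2 : ℝ) • x - y ∈ convexHull ℝ T} ∈ 𝓝 x := by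
    have hc : ContinuousAt (fun y : E => (2 : ℝ) • x - y) x := by fun_prop
    refine hc.preimage_mem_nhds ?_
    simpa [two_smul] using hN
  refine ⟨insert x hT.toFinset, η / 8, by positivity, _,
    inter_mem hV (inter_mem hN hN'), fun g hg hS y hy => ?_⟩
  have hup : ∀ z ∈ convexHull ℝ T, g z ≤ q x + η / 4 := by
    intro z hz
    obtain ⟨t, ht, hzt⟩ := hg.exists_ge_of_mem_convexHull (Set.subset_univ _) hz
    have h1 := hS t (Finset.mem_insert_of_mem (hT.mem_toFinset.2 ht))
    have h2 : |q t - q x| < η / 8 := hbV (subset_convexHull ℝ T ht)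
    linarith [(abs_le.1 h1).2, (abs_lt.1 h2).2]
  have hx := (abs_le.1 (hS x (Finset.mem_insert_self _ _))).1
  have h1 := hup y hy.2.1
  have h2 := hup _ hy.2.2
  have h3 : g x ≤ (1 / 2) * g y + (1 / 2) * g ((2 : ℝ) • x - y) := by
    have := hg.2 (Set.mem_univ y) (Set.mem_univ ((2 : ℝ) • x - y))
      (by norm_num : (0 : ℝ) ≤ 1 / 2) (by norm_num : (0 : ℝ) ≤ 1 / 2) (by norm_num)
    have he : (1 / 2 : ℝ) • y + (1 / 2 : ℝ) • ((2 : ℝ) • x - y) = x := by module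
    rw [he] at this
    simpa using this
  have h4 : |q y - q x| < η / 8 := hy.1
  rw [abs_lt] at h4
  rw [abs_le]
  constructor <;> linarith [h4.1, h4.2]

lemma exists_finset_forall_convexOn_of_isCompact [FiniteDimensional ℝ E] {q : E → ℝ}
    (hq : Continuous q) {K : Set E} (hK : IsCompact K) {η : ℝ} (hη : 0 < η) :
    ∃ S : Finset E, ∃ δ > 0, ∀ g : E → ℝ, ConvexOn ℝ Set.univ g →
      (∀ s ∈ S, |g s - q s| ≤ δ) → ∀ y ∈ K, |g y - q y| ≤ η := by
  classical
  refine hK.induction_on ⟨∅, 1, one_pos, by simp⟩ ?_ ?_ ?_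
  · rintro s t hst ⟨S, δ, hδ, h⟩
    exact ⟨S, δ, hδ, fun g hg hS y hy => h g hg hS y (hst hy)⟩
  · rintro s t ⟨S, δ, hδ, h⟩ ⟨S', δ', hδ', h'⟩
    refine ⟨S ∪ S', min δ δ', lt_min hδ hδ', fun g hg hS y hy => ?_⟩
    rcases hy with hy | hy
    · exact h g hg (fun s hs => (hS s (Finset.mem_union_left _ hs)).trans (min_le_left _ _)) y hy
    · exact h' g hg (fun s hs => (hS s (Finset.mem_union_right _ hs)).trans (min_le_right _ _)) y hy
  · intro x _
    obtain ⟨S, δ, hδ, U, hU, h⟩ := exists_finset_forall_convexOn_near hq x hη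
    exact ⟨U, mem_nhdsWithin_of_mem_nhds hU, S, δ, hδ, h⟩

/-- A sublevel point of a convex function lies in a ball if the function is larger on the sphere. -/
lemma norm_sub_lt_of_convexOn {H : E → ℝ} (hH : ConvexOn ℝ Set.univ H) {a u : E} {δ : ℝ}
    (hδ : 0 < δ) (hs : ∀ v, ‖v - a‖ = δ → H a < H v) (hu : H u ≤ H a) : ‖u - a‖ < δ := by
  by_contra! hc
  have hpos : 0 < ‖u - a‖ := hδ.trans_le hc
  have ht1 : δ / ‖u - a‖ ≤ 1 := (div_le_one hpos).2 hc
  have ht0 : 0 ≤ δ / ‖u - a‖ := by positivity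
  -- The segment from `a` to `u` crosses the sphere here, where convexity keeps `H` at most `H a`.
  have h1 := hs ((1 - δ / ‖u - a‖) • a + (δ / ‖u - a‖) • u) (by
    have : (1 - δ / ‖u - a‖) • a + (δ / ‖u - a‖) • u - a = (δ / ‖u - a‖) • (u - a) := by module
    rw [this, norm_smul, Real.norm_of_nonneg ht0, div_mul_cancel₀ _ hpos.ne'])
  have h2 := hH.2 (Set.mem_univ a) (Set.mem_univ u) (sub_nonneg.2 ht1) ht0 (by ring)
  simp only [smul_eq_mul] at h2
  nlinarith

end Convex

/-! ### Localization of minimizers near a quadratic limit -/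

section Quadratic

variable {E : Type*} [NormedAddCommGroup E] [InnerProductSpace ℝ E]

/-- Localisation of an approximate minimizer of a convex function that is uniformly close
to a coercive quadratic function plus a convex penalty. -/
lemma norm_sub_lt_of_quadratic_approx {Z pen : E → ℝ} {L : E →L[ℝ] E}
    (hZ : ConvexOn ℝ Set.univ Z) (hpen : ConvexOn ℝ Set.univ pen)
    (hL : ∀ x y, inner ℝ x (L y) = inner ℝ y (L x)) {lam c η κ M δ : ℝ} (hc : 0 < c)
    (hlam : ∀ x, lam * ‖x‖ ^ 2 ≤ inner ℝ x (L x)) {W a u : E} (hδ : 0 < δ)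
    (hM : ‖a‖ + δ ≤ M) (hη : ∀ x, ‖x‖ ≤ M → |Z x - c / 2 * inner ℝ x (L x)| ≤ η)
    (hκ : ∀ x, ‖x - a‖ = δ → -κ ≤ pen x - pen a + inner ℝ (c • L a - W) (x - a))
    (hlt : 2 * η + κ < c / 2 * (lam * δ ^ 2))
    (hu : Z u - inner ℝ W u + pen u ≤ Z a - inner ℝ W a + pen a) : ‖u - a‖ < δ := by
  have hconv : ConvexOn ℝ Set.univ (fun x => Z x - inner ℝ W x + pen x) := by
    refine (hZ.sub ⟨convex_univ, fun x _ y _ s t _ _ _ => ?_⟩).add hpen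
    simp [inner_add_right, inner_smul_right]
  refine norm_sub_lt_of_convexOn hconv hδ (fun v hv => ?_) hu
  have h1 := hη a (by linarith)
  have h2 := hη v (by
    calc ‖v‖ = ‖a + (v - a)‖ := by congr 1; abel
      _ ≤ ‖a‖ + ‖v - a‖ := norm_add_le _ _
      _ ≤ M := by rw [hv]; exact hM)
  have h3 := hκ v hv
  have h4 := hlam (v - a)
  rw [hv] at h4
  -- Expanding the quadratic at `a`: its second-order part gains `c / 2 * (lam * δ ^ 2)` on the
  -- sphere. This must beat the two approximation errors `η` and the slack `κ` in the first-order
  -- condition.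
  have h5 : inner ℝ (v - a) (L (v - a))
      = inner ℝ v (L v) - 2 * inner ℝ (L a) v + inner ℝ a (L a) := by
    simp only [map_sub, inner_sub_left, inner_sub_right]
    rw [hL a v, real_inner_comm v (L a)]
    ring
  have h6 : inner ℝ (c • L a - W) (v - a)
      = c * inner ℝ (L a) v - c * inner ℝ a (L a) - inner ℝ W v + inner ℝ W a := by
    simp only [inner_sub_left, inner_sub_right, inner_smul_left]
    rw [real_inner_comm a (L a)]
    simp
    ring
  rw [abs_le] at h1 h2
  have h7 : c / 2 * (lam * δ ^ 2) ≤ c / 2 * inner ℝ (v - a) (L (v - a)) :=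
    mul_le_mul_of_nonneg_left h4 (by positivity)
  rw [h5] at h7
  rw [h6] at h3
  linarith [h1.1, h1.2, h2.1, h2.2]

/-- A linear map that is positive on nonzero vectors is coercive in finite dimension. -/
lemma exists_pos_forall_mul_norm_sq_le [FiniteDimensional ℝ E] (L : E →L[ℝ] E)
    (hL : ∀ x, x ≠ 0 → 0 < inner ℝ x (L x)) :
    ∃ lam > 0, ∀ x, lam * ‖x‖ ^ 2 ≤ inner ℝ x (L x) := by
  rcases subsingleton_or_nontrivial E with h | h
  · refine ⟨1, one_pos, fun x => ?_⟩
    simp [Subsingleton.elim x 0]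
  obtain ⟨x0, hx0, hmin⟩ := (isCompact_sphere (0 : E) 1).exists_isMinOn
    (NormedSpace.sphere_nonempty.2 zero_le_one)
    (f := fun x => inner ℝ x (L x)) (by fun_prop)
  have hx0' : x0 ≠ 0 := by
    rintro rfl
    simp at hx0
  refine ⟨_, hL x0 hx0', fun x => ?_⟩
  rcases eq_or_ne x 0 with rfl | hx
  · simp
  have hn : 0 < ‖x‖ := norm_pos_iff.2 hx
  have h1 : inner ℝ x0 (L x0) ≤ inner ℝ (‖x‖⁻¹ • x) (L (‖x‖⁻¹ • x)) :=
    hmin (by simp [norm_smul, hn.ne'])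
  rw [map_smul, inner_smul_left, inner_smul_right] at h1
  calc _ ≤ _ := mul_le_mul_of_nonneg_right h1 (by positivity)
    _ = _ := by simp; field_simp

end Quadratic

/-! ### Group norms and reduction to finite weights -/

section Penalty

variable {p : ℕ} {d : Fin p → ℕ}

lemma inner_eq_sum_group (x y : Vec d) : inner ℝ x y = ∑ j, inner ℝ (group x j) (group y j) := by
  simp only [PiLp.inner_apply, group]
  exact Fintype.sum_sigma _

lemma norm_sq_eq_sum_group (x : Vec d) : ‖x‖ ^ 2 = ∑ j, ‖group x j‖ ^ 2 := by
  simp only [← real_inner_self_eq_norm_sq, inner_eq_sum_group]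

lemma norm_group_le (x : Vec d) (j : Fin p) : ‖group x j‖ ≤ ‖x‖ := by
  refine le_of_sq_le_sq ?_ (norm_nonneg x)
  rw [norm_sq_eq_sum_group]
  exact Finset.single_le_sum (f := fun j => ‖group x j‖ ^ 2) (fun _ _ => by positivity)
    (Finset.mem_univ j)

lemma group_add (x y : Vec d) (j : Fin p) : group (x + y) j = group x j + group y j := rfl

lemma group_sub (x y : Vec d) (j : Fin p) : group (x - y) j = group x j - group y j := rfl

lemma group_smul (c : ℝ) (x : Vec d) (j : Fin p) : group (c • x) j = c • group x j := rfl

lemma weight_of_ne_zero {γ : ℝ} {b : Vec d} {j : Fin p} (hb : group b j ≠ 0) :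
    weight γ b j = ENNReal.ofReal (‖group b j‖ ^ (-γ)) := by
  rw [weight, ← ofReal_norm, ENNReal.ofReal_rpow_of_pos (norm_pos_iff.2 hb)]

lemma weight_of_eq_zero {γ : ℝ} (hγ : 0 < γ) {b : Vec d} {j : Fin p} (hb : group b j = 0) :
    weight γ b j = ⊤ := by
  simp [weight, hb, hγ]

/-- Infinite weights may be replaced by arbitrary finite ones. -/
lemma realPenalized_le_of_penalizedProcess_le {τ γ m : ℝ} (hτ : τ ∈ Set.Ioo (0 : ℝ) 1)
    (hγ : 0 < γ) (hm : 0 < m) {X : ℕ → Vec d} {y : ℕ → ℝ} {n : ℕ} {bInit b b' : Vec d} (K : ℝ)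
    (hK : 0 ≤ K) (hb' : ∀ j, group bInit j = 0 → group b' j = 0)
    (hle : penalizedProcess τ γ m X y n bInit b ≤ penalizedProcess τ γ m X y n bInit b') :
    let c : Fin p → ℝ := fun j => if group bInit j = 0 then K else m * ‖group bInit j‖ ^ (-γ)
    quantileProcess τ X y n b + ∑ j, c j * ‖group b j‖
      ≤ quantileProcess τ X y n b' + ∑ j, c j * ‖group b' j‖ := by
  intro c
  have hc : ∀ j, 0 ≤ c j := by
    intro j
    simp only [c]
    split_ifs <;> positivity
  have hq : ∀ b, 0 ≤ quantileProcess τ X y n b := fun b =>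
    Finset.sum_nonneg fun i _ => checkLoss_nonneg hτ _
  have hm' : ENNReal.ofReal m ≠ 0 := by simpa using hm
  have key : ∀ b : Vec d, (∀ j, group bInit j = 0 → group b j = 0) →
      penalizedProcess τ γ m X y n bInit b
        = ENNReal.ofReal (quantileProcess τ X y n b + ∑ j, c j * ‖group b j‖) := by
    intro b hb
    rw [penalizedProcess, ENNReal.ofReal_add (hq b)
      (Finset.sum_nonneg fun j _ => mul_nonneg (hc j) (norm_nonneg _)),
      ENNReal.ofReal_sum_of_nonneg fun j _ => mul_nonneg (hc j) (norm_nonneg _), Finset.mul_sum]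
    congr 1
    refine Finset.sum_congr rfl fun j _ => ?_
    by_cases h0 : group bInit j = 0
    · simp [hb j h0]
    · rw [weight_of_ne_zero h0, ENNReal.ofReal_mul (hc j), ofReal_norm]
      simp only [c, if_neg h0]
      rw [ENNReal.ofReal_mul hm.le, mul_assoc]
  -- The competitor `b'` has a finite objective, so `b` cannot be nonzero on a group of infinite
  -- weight; on such groups both norms vanish and `K` plays no role.
  have hb : ∀ j, group bInit j = 0 → group b j = 0 := by
    intro j hj
    by_contra hne
    have hfin : penalizedProcess τ γ m X y n bInit b < ⊤ :=
      hle.trans_lt (by rw [key b' hb']; exact ENNReal.ofReal_lt_top)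
    have h1 : ENNReal.ofReal m * (weight γ bInit j * ‖group b j‖ₑ) ≤
        penalizedProcess τ γ m X y n bInit b := by
      refine le_trans ?_ le_add_self
      gcongr
      exact Finset.single_le_sum (f := fun j => weight γ bInit j * ‖group b j‖ₑ)
        (fun _ _ => zero_le) (Finset.mem_univ j)
    rw [weight_of_eq_zero hγ hj, ENNReal.top_mul (by simpa using hne), ENNReal.mul_top hm'] at h1
    exact absurd (h1.trans_lt hfin) (lt_irrefl _)
  rw [key b hb, key b' hb'] at hle
  exact (ENNReal.ofReal_le_ofReal_iff (add_nonneg (hq b')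
    (Finset.sum_nonneg fun j _ => mul_nonneg (hc j) (norm_nonneg _)))).1 hle

end Penalty

end

section

/-! ### Expected remainder under a density near zero -/

section Density

lemma knightRemainder_eq_indicator (x h : ℝ) : knightRemainder x h =
    (Set.Ico 0 h).indicator (fun x => h - x) x + (Set.Ico h 0).indicator (fun x => x - h) x := by
  unfold knightRemainder
  by_cases hx : x < 0
  · have h1 : x ∉ Set.Ico 0 h := fun h => absurd h.1 (not_le.2 hx)
    rw [if_pos hx, Set.indicator_of_notMem h1, zero_add]
    by_cases hh : h ≤ x
    · rw [Set.indicator_of_mem (show x ∈ Set.Ico h 0 from ⟨hh, hx⟩), max_eq_left (by linarith)]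
    · rw [Set.indicator_of_notMem (fun h => hh h.1), max_eq_right (by linarith)]
  · have h1 : x ∉ Set.Ico h 0 := fun h => hx h.2
    rw [if_neg hx, Set.indicator_of_notMem h1, add_zero]
    by_cases hh : x < h
    · rw [Set.indicator_of_mem (show x ∈ Set.Ico 0 h from ⟨not_lt.1 hx, hh⟩), max_eq_left (by linarith)]
    · rw [Set.indicator_of_notMem (fun h => hh h.2), max_eq_right (by linarith)]

lemma integrable_knightRemainder (h : ℝ) : Integrable (fun x => knightRemainder x h) := by
  simp_rw [knightRemainder_eq_indicator]
  refine Integrable.add ?_ ?_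
  · exact (integrable_indicator_iff measurableSet_Ico).2
      ((Continuous.integrableOn_Icc (by fun_prop)).mono_set Set.Ico_subset_Icc_self)
  · exact (integrable_indicator_iff measurableSet_Ico).2
      ((Continuous.integrableOn_Icc (by fun_prop)).mono_set Set.Ico_subset_Icc_self)

/-- The area of a right triangle with both legs `|h|`. -/
lemma integral_knightRemainder (h : ℝ) : ∫ x, knightRemainder x h = h ^ 2 / 2 := by
  simp_rw [knightRemainder_eq_indicator]
  rw [integral_add]
  rotate_left
  · exact (integrable_indicator_iff measurableSet_Ico).2
      ((Continuous.integrableOn_Icc (by fun_prop)).mono_set Set.Ico_subset_Icc_self)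
  · exact (integrable_indicator_iff measurableSet_Ico).2
      ((Continuous.integrableOn_Icc (by fun_prop)).mono_set Set.Ico_subset_Icc_self)
  rw [integral_indicator measurableSet_Ico, integral_indicator measurableSet_Ico,
    integral_Ico_eq_integral_Ioc, integral_Ico_eq_integral_Ioc]
  rcases le_total 0 h with hh | hh
  · rw [← intervalIntegral.integral_of_le hh, Set.Ioc_eq_empty (not_lt.2 hh),
      intervalIntegral.integral_comp_sub_left (fun y => y)]
    simp
  · rw [← intervalIntegral.integral_of_le hh, Set.Ioc_eq_empty (not_lt.2 hh)]
    simp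
    ring

/-- The expected Knight remainder is asymptotic to `f 0 * h ^ 2 / 2`. -/
lemma exists_forall_abs_integral_knightRemainder_sub_le {ν : Measure ℝ} {f : ℝ → ℝ}
    {U : Set ℝ} (hU : IsOpen U) (h0 : 0 ∈ U) (hf : ContinuousOn f U) (hpos : ∀ x ∈ U, 0 < f x)
    (hν : ν.restrict U = (volume.restrict U).withDensity (fun x => ENNReal.ofReal (f x)))
    {η : ℝ} (hη : 0 < η) :
    ∃ δ > 0, ∀ h, |h| ≤ δ → |∫ x, knightRemainder x h ∂ν - f 0 / 2 * h ^ 2| ≤ η * h ^ 2 := by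
  have hnhds : U ∩ {x | |f x - f 0| < η} ∈ 𝓝 (0 : ℝ) := by
    refine inter_mem (hU.mem_nhds h0) ?_
    have := (hf.continuousAt (hU.mem_nhds h0)).tendsto (Metric.ball_mem_nhds (f 0) hη)
    simpa [Real.dist_eq, Set.preimage, Metric.ball] using this
  obtain ⟨δ, hδ, hball⟩ := Metric.mem_nhds_iff.1 hnhds
  refine ⟨δ / 2, by positivity, fun h hh => ?_⟩
  have hB : MeasurableSet (Metric.ball (0 : ℝ) δ) := measurableSet_ball
  have hBU : Metric.ball (0 : ℝ) δ ⊆ U := fun x hx => (hball hx).1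
  -- Since `|h| ≤ δ / 2`, the integral over `ν` only sees the ball where the density exists and is
  -- within `η` of `f 0`.
  have hvan : ∀ x ∉ Metric.ball (0 : ℝ) δ, knightRemainder x h = 0 := by
    intro x hx
    refine knightRemainder_eq_zero ?_
    simp only [Metric.mem_ball, dist_zero_right, Real.norm_eq_abs, not_lt] at hx
    linarith
  have hrestr : ν.restrict (Metric.ball 0 δ) = (volume.restrict (Metric.ball 0 δ)).withDensity
      (fun x => ENNReal.ofReal (f x)) := by
    have := congrArg (fun m => m.restrict (Metric.ball (0 : ℝ) δ)) hν
    simp only [restrict_withDensity hB] at this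
    rwa [Measure.restrict_restrict hB, Measure.restrict_restrict hB,
      Set.inter_eq_left.2 hBU] at this
  have hfm : AEMeasurable f (volume.restrict (Metric.ball 0 δ)) :=
    (hf.mono hBU).aemeasurable hB
  have h1 : ∫ x, knightRemainder x h ∂ν
      = ∫ x in Metric.ball 0 δ, f x * knightRemainder x h := by
    rw [← setIntegral_eq_integral_of_forall_compl_eq_zero hvan, hrestr,
      integral_withDensity_eq_integral_toReal_smul₀ hfm.ennreal_ofReal
        (ae_of_all _ fun _ => ENNReal.ofReal_lt_top)]
    refine setIntegral_congr_fun hB fun x hx => ?_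
    simp [ENNReal.toReal_ofReal (hpos x (hBU hx)).le]
  have hR : Integrable (fun x => knightRemainder x h) (volume.restrict (Metric.ball 0 δ)) :=
    (integrable_knightRemainder h).restrict
  have h2 : ∫ x in Metric.ball 0 δ, knightRemainder x h = h ^ 2 / 2 := by
    rw [setIntegral_eq_integral_of_forall_compl_eq_zero hvan, integral_knightRemainder]
  have hbd : ∀ᵐ x ∂(volume.restrict (Metric.ball (0 : ℝ) δ)), ‖f x - f 0‖ ≤ η :=
    (ae_restrict_iff' hB).2 (ae_of_all _ fun x hx => (hball hx).2.le)
  have hint : Integrable (fun x => (f x - f 0) * knightRemainder x h)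
      (volume.restrict (Metric.ball 0 δ)) :=
    hR.bdd_mul (hfm.sub aemeasurable_const).aestronglyMeasurable hbd
  have h3 : ∫ x, knightRemainder x h ∂ν - f 0 / 2 * h ^ 2
      = ∫ x in Metric.ball 0 δ, (f x - f 0) * knightRemainder x h := by
    have : ∀ x, f x * knightRemainder x h
        = (f x - f 0) * knightRemainder x h + f 0 * knightRemainder x h := fun x => by ring
    rw [h1]
    simp_rw [this]
    rw [integral_add hint (hR.const_mul _), integral_const_mul, h2]
    ring
  rw [h3, ← Real.norm_eq_abs]
  calc _ ≤ ∫ x in Metric.ball 0 δ, η * knightRemainder x h := by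
        refine norm_integral_le_of_norm_le (hR.const_mul _) ?_
        filter_upwards [hbd] with x hx
        rw [norm_mul, Real.norm_of_nonneg (knightRemainder_nonneg x h)]
        exact mul_le_mul_of_nonneg_right hx (knightRemainder_nonneg x h)
    _ = η * (h ^ 2 / 2) := by rw [integral_const_mul, h2]
    _ ≤ η * h ^ 2 := by nlinarith [mul_nonneg hη.le (sq_nonneg h)]

/-- The score uses `x < 0` while the distribution function uses `x ≤ 0`; the density rules out an
atom at `0`. -/
lemma measureReal_Iio_zero_of_density {ν : Measure ℝ} [IsProbabilityMeasure ν] {f : ℝ → ℝ}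
    {U : Set ℝ} (h0 : 0 ∈ U)
    (hν : ν.restrict U = (volume.restrict U).withDensity (fun x => ENNReal.ofReal (f x))) {τ : ℝ}
    (hq : cdf ν 0 = τ) : ν.real (Set.Iio 0) = τ := by
  have hz : ν {0} = 0 := by
    have h1 : ν.restrict U {0} = 0 := by
      rw [hν, withDensity_apply _ (measurableSet_singleton 0)]
      refine setLIntegral_measure_zero _ _ ?_
      rw [Measure.restrict_apply (measurableSet_singleton 0)]
      exact measure_mono_null Set.inter_subset_left (by simp)
    rw [Measure.restrict_apply (measurableSet_singleton 0),
      Set.inter_eq_left.2 (Set.singleton_subset_iff.2 h0)] at h1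
    exact h1
  rw [← hq, cdf_eq_real]
  exact measureReal_congr (Iio_ae_eq_Iic' hz)

end Density

/-! ### Characteristic functions of weighted sums of scores -/

section Score

lemma integral_comp_score {ν : Measure ℝ} [IsProbabilityMeasure ν] {τ : ℝ}
    (hν : ν.real (Set.Iio 0) = τ) {F : Type*} [NormedAddCommGroup F] [NormedSpace ℝ F]
    [CompleteSpace F] (g : ℝ → F) :
    ∫ x, g (score τ x) ∂ν = τ • g (τ - 1) + (1 - τ) • g τ := by
  have h : ∀ x, g (score τ x) = (Set.Iio (0 : ℝ)).indicator (fun _ => g (τ - 1)) x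
      + ((Set.Iio (0 : ℝ))ᶜ).indicator (fun _ => g τ) x := by
    intro x
    by_cases hx : x < 0
    · simp [score, hx, Set.indicator]
    · simp [score, hx, Set.indicator]
  simp_rw [h]
  rw [integral_add ((integrable_const _).indicator measurableSet_Iio)
    ((integrable_const _).indicator measurableSet_Iio.compl),
    integral_indicator_const _ measurableSet_Iio,
    integral_indicator_const _ measurableSet_Iio.compl, probReal_compl_eq_one_sub measurableSet_Iio,
    hν]

/-- The characteristic function of the score of an error. -/
noncomputable def scoreCharFun (τ x : ℝ) : ℂ :=
  τ * Complex.exp (((τ - 1) * x : ℝ) * Complex.I) + (1 - τ) * Complex.exp ((τ * x : ℝ) * Complex.I)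

lemma norm_scoreCharFun_le {τ : ℝ} (hτ : τ ∈ Set.Ioo (0 : ℝ) 1) (x : ℝ) :
    ‖scoreCharFun τ x‖ ≤ 1 := by
  unfold scoreCharFun
  refine (norm_add_le _ _).trans ?_
  have h1 : ‖(1 - τ : ℂ)‖ = 1 - τ := by
    rw [← Complex.ofReal_one, ← Complex.ofReal_sub, Complex.norm_real,
      Real.norm_of_nonneg (by linarith [hτ.2])]
  rw [norm_mul, norm_mul, Complex.norm_exp_ofReal_mul_I, Complex.norm_exp_ofReal_mul_I, h1,
    Complex.norm_real, Real.norm_of_nonneg hτ.1.le]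
  linarith

lemma norm_exp_mul_I_sub_le {y : ℝ} (hy : |y| ≤ 1) :
    ‖Complex.exp (y * Complex.I) - (1 + y * Complex.I - y ^ 2 / 2)‖ ≤ |y| ^ 3 / 4 := by
  have hn : ‖(y * Complex.I : ℂ)‖ = |y| := by simp
  have := Complex.exp_bound (x := y * Complex.I) (by rw [hn]; exact hy) (n := 3) (by norm_num)
  rw [hn] at this
  have he : ∑ m ∈ Finset.range 3, (y * Complex.I : ℂ) ^ m / m.factorial
      = 1 + y * Complex.I - y ^ 2 / 2 := by
    simp [Finset.sum_range_succ, Nat.factorial, mul_pow]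
    ring
  rw [he] at this
  refine this.trans ?_
  norm_num [Nat.factorial]
  nlinarith [pow_nonneg (abs_nonneg y) 3]

/-- The score has mean zero and variance `τ (1 - τ)`, so its characteristic function agrees to
second order with the Gaussian one. -/
lemma norm_scoreCharFun_sub_exp_le {τ : ℝ} (hτ : τ ∈ Set.Ioo (0 : ℝ) 1) {x : ℝ} (hx : |x| ≤ 1) :
    ‖scoreCharFun τ x - Complex.exp ((-(τ * (1 - τ) * x ^ 2 / 2) : ℝ))‖ ≤ |x| ^ 3 := by
  obtain ⟨h0, h1⟩ := hτ
  have hx0 := abs_nonneg x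
  have ha : |(τ - 1) * x| ≤ |x| := by
    rw [abs_mul]
    exact mul_le_of_le_one_left hx0 (abs_le.2 ⟨by linarith, by linarith⟩)
  have hb : |τ * x| ≤ |x| := by
    rw [abs_mul]
    exact mul_le_of_le_one_left hx0 (abs_le.2 ⟨by linarith, by linarith⟩)
  have e1 := (norm_exp_mul_I_sub_le (ha.trans hx)).trans
    (div_le_div_of_nonneg_right (pow_le_pow_left₀ (abs_nonneg _) ha 3) (by norm_num))
  have e2 := (norm_exp_mul_I_sub_le (hb.trans hx)).trans
    (div_le_div_of_nonneg_right (pow_le_pow_left₀ (abs_nonneg _) hb 3) (by norm_num))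
  set z : ℝ := -(τ * (1 - τ) * x ^ 2 / 2) with hz
  have hzabs : |z| ≤ x ^ 2 / 2 := by
    rw [hz, abs_neg, abs_of_nonneg (by
      have := mul_nonneg h0.le (sub_nonneg.2 h1.le); positivity)]
    have : τ * (1 - τ) ≤ 1 := by nlinarith
    nlinarith [sq_nonneg x]
  have hx2 : x ^ 2 ≤ |x| := by
    rw [← sq_abs]
    nlinarith
  have e3 : ‖Complex.exp (z : ℂ) - 1 - z‖ ≤ |x| ^ 3 / 4 := by
    have hn : ‖(z : ℂ)‖ = |z| := by simp
    refine (Complex.norm_exp_sub_one_sub_id_le (by rw [hn]; nlinarith)).trans ?_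
    rw [hn]
    calc |z| ^ 2 ≤ (x ^ 2 / 2) ^ 2 := pow_le_pow_left₀ (abs_nonneg _) hzabs 2
      _ = (|x| ^ 2) * x ^ 2 / 4 := by rw [sq_abs]; ring
      _ ≤ |x| ^ 2 * |x| / 4 := by gcongr
      _ = _ := by ring
  have hτn : ‖(τ : ℂ)‖ = τ := by simp [h0.le]
  have hτn' : ‖(1 - τ : ℂ)‖ = 1 - τ := by
    rw [← Complex.ofReal_one, ← Complex.ofReal_sub, Complex.norm_real,
      Real.norm_of_nonneg (by linarith)]
  -- The Taylor polynomials may be inserted because the linear terms cancel and the quadratic ones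
  -- add up to `z`.
  have hid : scoreCharFun τ x - Complex.exp (z : ℂ)
      = τ * (Complex.exp (((τ - 1) * x : ℝ) * Complex.I)
          - (1 + ((τ - 1) * x : ℝ) * Complex.I - ((τ - 1) * x : ℝ) ^ 2 / 2))
        + (1 - τ) * (Complex.exp ((τ * x : ℝ) * Complex.I)
          - (1 + (τ * x : ℝ) * Complex.I - (τ * x : ℝ) ^ 2 / 2))
        - (Complex.exp (z : ℂ) - 1 - z) := by
    unfold scoreCharFun
    rw [hz]
    push_cast
    ring
  rw [hid]
  refine (norm_sub_le _ _).trans ?_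
  refine (add_le_add (norm_add_le _ _) e3).trans ?_
  rw [norm_mul, norm_mul, hτn, hτn']
  have := mul_le_mul_of_nonneg_left e1 h0.le
  have := mul_le_mul_of_nonneg_left e2 (sub_nonneg.2 h1.le)
  nlinarith [pow_nonneg hx0 3]

/-- Telescoping: replace one factor at a time, the others having norm at most one. -/
lemma norm_prod_sub_prod_le {ι : Type*} (s : Finset ι) (a b : ι → ℂ) (ha : ∀ i ∈ s, ‖a i‖ ≤ 1)
    (hb : ∀ i ∈ s, ‖b i‖ ≤ 1) : ‖∏ i ∈ s, a i - ∏ i ∈ s, b i‖ ≤ ∑ i ∈ s, ‖a i - b i‖ := by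
  classical
  induction s using Finset.induction_on with
  | empty => simp
  | insert i s hi ih =>
    rw [Finset.prod_insert hi, Finset.prod_insert hi, Finset.sum_insert hi]
    have h1 := ih (fun j hj => ha j (Finset.mem_insert_of_mem hj))
      (fun j hj => hb j (Finset.mem_insert_of_mem hj))
    have hA : ‖∏ j ∈ s, a j‖ ≤ 1 := by
      rw [norm_prod]
      exact Finset.prod_le_one (fun _ _ => norm_nonneg _)
        fun j hj => ha j (Finset.mem_insert_of_mem hj)
    have hB := hb i (Finset.mem_insert_self _ _)
    calc _ = ‖(a i - b i) * ∏ j ∈ s, a j + b i * (∏ j ∈ s, a j - ∏ j ∈ s, b j)‖ := by ring_nf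
      _ ≤ ‖a i - b i‖ * ‖∏ j ∈ s, a j‖ + ‖b i‖ * ‖∏ j ∈ s, a j - ∏ j ∈ s, b j‖ := by
        refine (norm_add_le _ _).trans ?_
        rw [norm_mul, norm_mul]
      _ ≤ ‖a i - b i‖ * 1 + 1 * ∑ j ∈ s, ‖a j - b j‖ := by gcongr
      _ = _ := by ring

variable {a : ℕ → ℕ → ℝ} {s : ℝ}

/-- Lindeberg's argument for the characteristic functions of weighted sums of scores. -/
lemma tendsto_prod_scoreCharFun {τ : ℝ} (hτ : τ ∈ Set.Ioo (0 : ℝ) 1)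
    (hmax : ∀ η > 0, ∀ᶠ n in atTop, ∀ i < n, |a n i| ≤ η)
    (hsq : Tendsto (fun n => ∑ i ∈ Finset.range n, a n i ^ 2) atTop (𝓝 s)) :
    Tendsto (fun n => ∏ i ∈ Finset.range n, scoreCharFun τ (a n i)) atTop
      (𝓝 (Complex.exp ((-(τ * (1 - τ) * s / 2) : ℝ)))) := by
  have hexp : Tendsto (fun n => ∏ i ∈ Finset.range n,
      Complex.exp ((-(τ * (1 - τ) * a n i ^ 2 / 2) : ℝ))) atTop
      (𝓝 (Complex.exp ((-(τ * (1 - τ) * s / 2) : ℝ)))) := by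
    simp_rw [← Complex.exp_sum, ← Complex.ofReal_sum]
    refine (Complex.continuous_exp.tendsto _).comp ((Complex.continuous_ofReal.tendsto _).comp ?_)
    have := (hsq.const_mul (τ * (1 - τ))).div_const 2 |>.neg
    refine this.congr fun n => ?_
    rw [Finset.sum_neg_distrib, Finset.mul_sum, Finset.sum_div]
  have hdiff : Tendsto (fun n => ∏ i ∈ Finset.range n, scoreCharFun τ (a n i)
      - ∏ i ∈ Finset.range n, Complex.exp ((-(τ * (1 - τ) * a n i ^ 2 / 2) : ℝ))) atTop (𝓝 0) := by
    rw [Metric.tendsto_nhds]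
    intro ε hε
    have hs1 : ∀ᶠ n in atTop, ∑ i ∈ Finset.range n, a n i ^ 2 < |s| + 1 :=
      hsq.eventually_lt_const (by linarith [le_abs_self s])
    have hηpos : 0 < min 1 (ε / (2 * (|s| + 1))) := by positivity
    filter_upwards [hs1, hmax _ hηpos] with n hn hm
    rw [dist_zero_right]
    refine (norm_prod_sub_prod_le _ _ _ (fun i _ => norm_scoreCharFun_le hτ _)
      (fun i _ => ?_)).trans_lt ?_
    · rw [Complex.norm_exp, Complex.ofReal_re, Real.exp_le_one_iff]
      have := mul_nonneg hτ.1.le (sub_nonneg.2 hτ.2.le)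
      have : 0 ≤ τ * (1 - τ) * a n i ^ 2 / 2 := by positivity
      linarith
    · calc _ ≤ ∑ i ∈ Finset.range n, (ε / (2 * (|s| + 1))) * a n i ^ 2 := by
            refine Finset.sum_le_sum fun i hi => ?_
            have h := hm i (Finset.mem_range.1 hi)
            refine (norm_scoreCharFun_sub_exp_le hτ (h.trans (min_le_left _ _))).trans ?_
            rw [pow_succ', sq_abs]
            exact mul_le_mul_of_nonneg_right (h.trans (min_le_right _ _)) (sq_nonneg _)
        _ = (ε / (2 * (|s| + 1))) * ∑ i ∈ Finset.range n, a n i ^ 2 := by rw [Finset.mul_sum]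
        _ ≤ (ε / (2 * (|s| + 1))) * (|s| + 1) := by gcongr
        _ = ε / 2 := by field_simp
        _ < ε := by linarith
  have := hdiff.add hexp
  simpa using this

end Score

/-! ### Sums over the i.i.d. errors -/

section Sums

variable {Ω : Type*} [MeasurableSpace Ω] {P : Measure Ω} {ε : ℕ → Ω → ℝ}
  {ν : Measure ℝ}

/-- Chebyshev's inequality for a sum of bounded functions of i.i.d. variables. -/
lemma measure_le_abs_sum_sub_le [IsProbabilityMeasure P] (hind : iIndepFun ε P) (hlaw : ∀ i, HasLaw (ε i) ν P)
    (s : Finset ℕ) {g : ℕ → ℝ → ℝ} (hg : ∀ i, Measurable (g i)) {K : ℕ → ℝ}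
    (hK : ∀ i x, |g i x| ≤ K i) {c : ℝ} (hc : 0 < c) :
    P {ω | c ≤ |∑ i ∈ s, g i (ε i ω) - ∑ i ∈ s, ∫ x, g i x ∂ν|}
      ≤ ENNReal.ofReal ((∑ i ∈ s, ∫ x, g i x ^ 2 ∂ν) / c ^ 2) := by
  have hm : ∀ i, AEMeasurable (fun ω => g i (ε i ω)) P := fun i =>
    (hg i).comp_aemeasurable (hlaw i).aemeasurable
  have hL : ∀ i, MemLp (fun ω => g i (ε i ω)) 2 P := fun i =>
    MemLp.of_bound (hm i).aestronglyMeasurable (K i) (ae_of_all _ fun ω => hK i _)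
  have hmean : ∫ ω, ∑ i ∈ s, g i (ε i ω) ∂P = ∑ i ∈ s, ∫ x, g i x ∂ν := by
    rw [integral_finsetSum _ fun i _ => (hL i).integrable (by norm_num)]
    exact Finset.sum_congr rfl fun i _ => (hlaw i).integral_comp (hg i).aestronglyMeasurable
  have hsum : (fun ω => ∑ i ∈ s, g i (ε i ω)) = ∑ i ∈ s, fun ω => g i (ε i ω) := by
    ext ω; simp
  have hvar : Var[fun ω => ∑ i ∈ s, g i (ε i ω); P] ≤ ∑ i ∈ s, ∫ x, g i x ^ 2 ∂ν := by
    rw [hsum, IndepFun.variance_sum (fun i _ => hL i) fun i _ j _ hij =>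
      (hind.comp g hg).indepFun hij]
    refine Finset.sum_le_sum fun i _ => (variance_le_expectation_sq (hm i).aestronglyMeasurable).trans
      (le_of_eq ?_)
    exact (hlaw i).integral_comp ((hg i).pow_const 2).aestronglyMeasurable
  rw [← hmean]
  refine (meas_ge_le_variance_div_sq (hsum ▸ memLp_finsetSum' s fun i _ => hL i) hc).trans ?_
  gcongr

variable {a : ℕ → ℕ → ℝ} {s : ℝ}

/-- The sum of the Knight remainders converges in probability to a quadratic limit. -/
lemma tendsto_measure_sum_knightRemainder [IsProbabilityMeasure P] [IsFiniteMeasure ν]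
    (hind : iIndepFun ε P) (hlaw : ∀ i, HasLaw (ε i) ν P)
    {c0 : ℝ} (hν : ∀ η > 0, ∃ δ > 0, ∀ h, |h| ≤ δ →
      |∫ x, knightRemainder x h ∂ν - c0 / 2 * h ^ 2| ≤ η * h ^ 2)
    (hmax : ∀ η > 0, ∀ᶠ n in atTop, ∀ i < n, |a n i| ≤ η)
    (hsq : Tendsto (fun n => ∑ i ∈ Finset.range n, a n i ^ 2) atTop (𝓝 s)) {c : ℝ} (hc : 0 < c) :
    Tendsto (fun n => P {ω | c ≤ |∑ i ∈ Finset.range n, knightRemainder (ε i ω) (a n i)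
      - c0 / 2 * s|}) atTop (𝓝 0) := by
  set m : ℕ → ℝ := fun n => ∑ i ∈ Finset.range n, ∫ x, knightRemainder x (a n i) ∂ν with hm
  have hint : ∀ h, Integrable (fun x => knightRemainder x h) ν := fun h =>
    Integrable.of_bound (measurable_knightRemainder h).aestronglyMeasurable |h|
      (ae_of_all _ fun x => by
        rw [Real.norm_of_nonneg (knightRemainder_nonneg x h)]; exact knightRemainder_le_abs x h)
  have hs1 : ∀ᶠ n in atTop, ∑ i ∈ Finset.range n, a n i ^ 2 < |s| + 1 :=
    hsq.eventually_lt_const (by linarith [le_abs_self s])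
  have hmlim : Tendsto m atTop (𝓝 (c0 / 2 * s)) := by
    have h2 := hsq.const_mul (c0 / 2)
    have h1 : Tendsto (fun n => m n - c0 / 2 * ∑ i ∈ Finset.range n, a n i ^ 2) atTop (𝓝 0) := by
      rw [Metric.tendsto_nhds]
      intro e he
      obtain ⟨δ, hδ, H⟩ := hν (e / (2 * (|s| + 1))) (by positivity)
      filter_upwards [hs1, hmax δ hδ] with n hn hmx
      rw [dist_zero_right, hm, Real.norm_eq_abs, Finset.mul_sum, ← Finset.sum_sub_distrib]
      calc _ ≤ ∑ i ∈ Finset.range n, e / (2 * (|s| + 1)) * a n i ^ 2 :=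
            (Finset.abs_sum_le_sum_abs _ _).trans
              (Finset.sum_le_sum fun i hi => H _ (hmx i (Finset.mem_range.1 hi)))
        _ = e / (2 * (|s| + 1)) * ∑ i ∈ Finset.range n, a n i ^ 2 := by rw [Finset.mul_sum]
        _ ≤ e / (2 * (|s| + 1)) * (|s| + 1) := by gcongr
        _ = e / 2 := by field_simp
        _ < e := by linarith
    simpa using h1.add h2
  -- The remainder is at most `|a n i|`, so the second moments are bounded by `max |a n i|` times
  -- the convergent means.
  have hvlim : Tendsto (fun n => ∑ i ∈ Finset.range n, ∫ x, knightRemainder x (a n i) ^ 2 ∂ν)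
      atTop (𝓝 0) := by
    rw [Metric.tendsto_nhds]
    intro e he
    have hm1 : ∀ᶠ n in atTop, m n < |c0 / 2 * s| + 1 :=
      hmlim.eventually_lt_const (by linarith [le_abs_self (c0 / 2 * s)])
    filter_upwards [hm1, hmax (e / (2 * (|c0 / 2 * s| + 1))) (by positivity)] with n hn hmx
    rw [dist_zero_right, Real.norm_of_nonneg
      (Finset.sum_nonneg fun i _ => integral_nonneg fun x => sq_nonneg _)]
    calc _ ≤ ∑ i ∈ Finset.range n,
            e / (2 * (|c0 / 2 * s| + 1)) * ∫ x, knightRemainder x (a n i) ∂ν := by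
          refine Finset.sum_le_sum fun i hi => ?_
          rw [← integral_const_mul]
          refine integral_mono_of_nonneg (ae_of_all _ fun x => sq_nonneg _)
            ((hint _).const_mul _) (ae_of_all _ fun x => ?_)
          simp only [sq]
          exact mul_le_mul_of_nonneg_right
            ((knightRemainder_le_abs x _).trans (hmx i (Finset.mem_range.1 hi)))
            (knightRemainder_nonneg x _)
      _ = e / (2 * (|c0 / 2 * s| + 1)) * m n := by rw [hm, Finset.mul_sum]
      _ ≤ e / (2 * (|c0 / 2 * s| + 1)) * (|c0 / 2 * s| + 1) := by gcongr
      _ = e / 2 := by field_simp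
      _ < e := by linarith
  have hbound : Tendsto (fun n => ENNReal.ofReal
      ((∑ i ∈ Finset.range n, ∫ x, knightRemainder x (a n i) ^ 2 ∂ν) / (c / 2) ^ 2))
      atTop (𝓝 0) := by
    have := ENNReal.tendsto_ofReal (hvlim.div_const ((c / 2) ^ 2))
    simpa using this
  refine tendsto_of_tendsto_of_tendsto_of_le_of_le' tendsto_const_nhds hbound
    (Eventually.of_forall fun _ => zero_le) ?_
  -- Half of `c` covers the bias of the mean, the other half is left to Chebyshev.
  have hclose := (Metric.tendsto_nhds.1 hmlim) (c / 2) (by positivity)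
  filter_upwards [hclose] with n hn
  refine le_trans (measure_mono fun ω hω => ?_) (measure_le_abs_sum_sub_le hind hlaw
    (Finset.range n) (g := fun i x => knightRemainder x (a n i))
    (fun i => measurable_knightRemainder _) (K := fun i => |a n i|) (fun i x => by
      rw [abs_of_nonneg (knightRemainder_nonneg x _)]; exact knightRemainder_le_abs x _)
    (half_pos hc))
  simp only [Set.mem_ofPred_eq] at hω ⊢
  rw [Real.dist_eq] at hn
  have := abs_sub_le (∑ i ∈ Finset.range n, knightRemainder (ε i ω) (a n i)) (m n) (c0 / 2 * s)
  simp only [hm] at this hn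
  linarith

lemma charFun_map_sum_score_smul [IsProbabilityMeasure ν] (hind : iIndepFun ε P)
    (hlaw : ∀ i, HasLaw (ε i) ν P) {τ : ℝ}
    (hν : ν.real (Set.Iio 0) = τ) {E : Type*} [NormedAddCommGroup E] [InnerProductSpace ℝ E]
    [MeasurableSpace E] [BorelSpace E] [SecondCountableTopology E] (s : Finset ℕ) (v : ℕ → E)
    (t : E) :
    charFun (P.map fun ω => ∑ i ∈ s, score τ (ε i ω) • v i) t
      = ∏ i ∈ s, scoreCharFun τ (inner ℝ (v i) t) := by
  have hmeas : ∀ i, Measurable (fun x : ℝ => score τ x • v i) := fun i =>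
    (measurable_score τ).smul_const _
  have hm : ∀ i, AEMeasurable (fun ω => score τ (ε i ω) • v i) P := fun i =>
    (hmeas i).comp_aemeasurable (hlaw i).aemeasurable
  have hind' : iIndepFun (fun i ω => score τ (ε i ω) • v i) P :=
    hind.comp (fun i x => score τ x • v i) hmeas
  rw [iIndepFun.charFun_map_fun_finsetSum_eq_prod (fun i _ => hm i) (hind'.restrict s),
    Finset.prod_apply]
  refine Finset.prod_congr rfl fun i _ => ?_
  rw [charFun_apply, integral_map (hm i) (by fun_prop)]
  have h1 := (hlaw i).integral_comp (f := fun x =>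
    Complex.exp ((inner ℝ (score τ x • v i) t : ℝ) * Complex.I))
    (by
      have := hmeas i
      exact Measurable.aestronglyMeasurable (by fun_prop))
  refine Eq.trans h1 ?_
  rw [integral_comp_score hν
    (g := fun y => Complex.exp ((inner ℝ (y • v i) t : ℝ) * Complex.I))]
  simp only [inner_smul_left, scoreCharFun, Complex.real_smul]
  simp

end Sums

end

section

variable {p : ℕ} {d : Fin p → ℕ}

/-! ### Restriction to the relevant groups and its adjoint -/

section Restriction

variable {A : Finset (Fin p)}

/-- The restriction to the groups in `A` as a continuous linear map. -/
noncomputable def restrictToL (A : Finset (Fin p)) :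
    Vec d →L[ℝ] EuclideanSpace ℝ (IdxOn d A) :=
  LinearMap.toContinuousLinearMap
    { toFun := restrictTo A, map_add' := fun _ _ => rfl, map_smul' := fun _ _ => rfl }

lemma restrictToL_apply (b : Vec d) : restrictToL A b = restrictTo A b := rfl

/-- The extension by zero of a vector indexed by the groups in `A`. -/
noncomputable def extendByZero (y : EuclideanSpace ℝ (IdxOn d A)) : Vec d :=
  WithLp.toLp 2 (fun k => if h : k.1 ∈ A then y ⟨k, h⟩ else 0)

lemma extendByZero_of_mem (y : EuclideanSpace ℝ (IdxOn d A)) {k : Idx d} (h : k.1 ∈ A) :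
    extendByZero y k = y ⟨k, h⟩ := by simp [extendByZero, h]

lemma extendByZero_of_notMem (y : EuclideanSpace ℝ (IdxOn d A)) {k : Idx d} (h : k.1 ∉ A) :
    extendByZero y k = 0 := by simp [extendByZero, h]

lemma restrictToL_extendByZero (y : EuclideanSpace ℝ (IdxOn d A)) :
    restrictToL A (extendByZero y) = y := by
  ext k
  exact extendByZero_of_mem y k.2

lemma group_extendByZero (y : EuclideanSpace ℝ (IdxOn d A)) {j : Fin p} (hj : j ∉ A) :
    group (extendByZero y) j = 0 := by
  ext k
  exact extendByZero_of_notMem y (k := ⟨j, k⟩) hj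

lemma group_eq_zero_of_restrictToL_eq_zero {b : Vec d} (hb : restrictToL A b = 0) {j : Fin p}
    (hj : j ∈ A) : group b j = 0 := by
  ext k
  exact congrArg (fun v : EuclideanSpace ℝ (IdxOn d A) => v ⟨⟨j, k⟩, hj⟩) hb

lemma sum_mul_extendByZero (x : Idx d → ℝ) (y : EuclideanSpace ℝ (IdxOn d A)) :
    ∑ k, x k * extendByZero y k = ∑ k : IdxOn d A, x k.1 * y k := by
  rw [← Fintype.sum_subtype_add_sum_subtype (fun k : Idx d => k.1 ∈ A)]
  rw [Finset.sum_congr rfl fun (k : {k : Idx d // k.1 ∈ A}) _ =>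
      congrArg (x k.1 * ·) (extendByZero_of_mem y k.2),
    Finset.sum_eq_zero fun (k : {k : Idx d // ¬ k.1 ∈ A}) _ => by
      rw [extendByZero_of_notMem y k.2, mul_zero], add_zero]

/-- Extension by zero is the adjoint of restriction. -/
lemma inner_extendByZero (x : Vec d) (y : EuclideanSpace ℝ (IdxOn d A)) :
    inner ℝ x (extendByZero y) = inner ℝ (restrictToL A x) y := by
  have := sum_mul_extendByZero x.ofLp y
  simp only [PiLp.inner_apply, RCLike.inner_apply, conj_trivial] at *
  simp_rw [mul_comm _ (x.ofLp _)]
  rw [this]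
  exact Finset.sum_congr rfl fun k _ => mul_comm _ _

lemma norm_extendByZero (y : EuclideanSpace ℝ (IdxOn d A)) : ‖extendByZero y‖ = ‖y‖ := by
  rw [@norm_eq_sqrt_real_inner, @norm_eq_sqrt_real_inner, inner_extendByZero,
    restrictToL_extendByZero]

lemma restrictToL_toEuclideanCLM_extendByZero (Υ : Matrix (Idx d) (Idx d) ℝ)
    (y : EuclideanSpace ℝ (IdxOn d A)) :
    restrictToL A (Matrix.toEuclideanCLM (𝕜 := ℝ) Υ (extendByZero y))
      = Matrix.toEuclideanCLM (𝕜 := ℝ) (submatrixOn A Υ) y := by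
  ext k
  exact sum_mul_extendByZero (fun l => Υ k.1 l) y

end Restriction

/-! ### Local expansion of the penalized objective -/

section Expansion

/-- The normalized sum of the scores. -/
noncomputable def scoreSum (τ : ℝ) (X : ℕ → Vec d) (n : ℕ) (e : ℕ → ℝ) : Vec d :=
  ∑ i ∈ Finset.range n, score τ (e i) • ((√(n : ℝ))⁻¹ • X i)

/-- The sum of the Knight remainders at the local parameter `u`. -/
noncomputable def remainderSum (X : ℕ → Vec d) (n : ℕ) (e : ℕ → ℝ) (u : Vec d) : ℝ :=
  ∑ i ∈ Finset.range n, knightRemainder (e i) (inner ℝ ((√(n : ℝ))⁻¹ • X i) u)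

lemma convexOn_remainderSum (X : ℕ → Vec d) (n : ℕ) (e : ℕ → ℝ) :
    ConvexOn ℝ Set.univ (remainderSum X n e) := by
  have h : ∀ s : Finset ℕ, ConvexOn ℝ Set.univ (fun u =>
      ∑ i ∈ s, knightRemainder (e i) (inner ℝ ((√(n : ℝ))⁻¹ • X i) u)) := by
    intro s
    induction s using Finset.induction_on with
    | empty => simpa using convexOn_const (0 : ℝ) convex_univ
    | insert i s hi ih =>
      simp_rw [Finset.sum_insert hi]
      exact ((convexOn_knightRemainder (e i)).comp_linearMap
        (innerₗ (Vec d) ((√(n : ℝ))⁻¹ • X i))).add ih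
  exact h _

/-- Knight's identity for the quantile process. -/
lemma quantileProcess_add_smul (τ : ℝ) (X : ℕ → Vec d) (n : ℕ) {e y : ℕ → ℝ} {b u : Vec d}
    (hy : ∀ i, y i = inner ℝ (X i) b + e i) :
    quantileProcess τ X y n (b + (√(n : ℝ))⁻¹ • u) = ∑ i ∈ Finset.range n, checkLoss τ (e i)
      + (remainderSum X n e u - inner ℝ (scoreSum τ X n e) u) := by
  rw [quantileProcess, remainderSum, scoreSum, sum_inner, ← Finset.sum_sub_distrib,
    ← Finset.sum_add_distrib]
  refine Finset.sum_congr rfl fun i _ => ?_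
  have h : y i - inner ℝ (X i) (b + (√(n : ℝ))⁻¹ • u)
      = e i - inner ℝ ((√(n : ℝ))⁻¹ • X i) u := by
    rw [hy, inner_add_right, inner_smul_right, real_inner_smul_left]
    ring
  rw [h, checkLoss_sub, real_inner_smul_left _ _ (score τ (e i))]
  ring

lemma convexOn_penalty (c : Fin p → ℝ) (hc : ∀ j, 0 ≤ c j) (b : Vec d) (s : ℝ) :
    ConvexOn ℝ Set.univ (fun u : Vec d => ∑ j, c j * ‖group (b + s • u) j‖) := by
  refine ⟨convex_univ, fun x _ y _ t t' ht ht' htt => ?_⟩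
  simp only [smul_eq_mul, Finset.mul_sum, ← Finset.sum_add_distrib]
  refine Finset.sum_le_sum fun j _ => ?_
  have h : group (b + s • (t • x + t' • y)) j
      = t • group (b + s • x) j + t' • group (b + s • y) j := by
    simp only [group_add, group_smul]
    have : group b j = t • group b j + t' • group b j := by rw [← add_smul, htt, one_smul]
    conv_lhs => rw [this]
    module
  have h2 : ‖group (b + s • (t • x + t' • y)) j‖
      ≤ t * ‖group (b + s • x) j‖ + t' * ‖group (b + s • y) j‖ := by
    rw [h]
    refine (norm_add_le _ _).trans ?_
    rw [norm_smul, norm_smul, Real.norm_of_nonneg ht, Real.norm_of_nonneg ht']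
  nlinarith [mul_le_mul_of_nonneg_left h2 (hc j)]

/-- The approximate optimality condition at `a`, checked group by group. On `A` the gradient `g`
vanishes and the penalty changes by at most `κ * ‖u - a‖`. Off `A` the penalty is `c j * s * ‖group
u j‖`, which dominates the linear term because `‖g‖ ≤ C ≤ c j * s`. -/
lemma penalty_sub_add_inner_ge {A : Finset (Fin p)} {c : Fin p → ℝ} (hc : ∀ j, 0 ≤ c j)
    {s κ C : ℝ} (hs : 0 ≤ s) (hcA : ∀ j ∈ A, c j * s ≤ κ) (hcA' : ∀ j ∉ A, C ≤ c j * s)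
    (hκ : 0 ≤ κ) {b a g : Vec d} (hb : ∀ j ∉ A, group b j = 0) (ha : ∀ j ∉ A, group a j = 0)
    (hg : ∀ j ∈ A, group g j = 0) (hgC : ‖g‖ ≤ C) (u : Vec d) :
    -(p * (κ * ‖u - a‖)) ≤ ∑ j, c j * ‖group (b + s • u) j‖ - ∑ j, c j * ‖group (b + s • a) j‖
      + inner ℝ g (u - a) := by
  rw [inner_eq_sum_group, ← Finset.sum_sub_distrib, ← Finset.sum_add_distrib]
  have hconst : -(p * (κ * ‖u - a‖)) = ∑ _j : Fin p, -(κ * ‖u - a‖) := by simp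
  rw [hconst]
  refine Finset.sum_le_sum fun j _ => ?_
  by_cases hj : j ∈ A
  · rw [hg j hj, inner_zero_left, add_zero, ← mul_sub]
    have h1 : ‖group (b + s • a) j‖ - ‖group (b + s • u) j‖ ≤ s * ‖u - a‖ := by
      refine (norm_sub_norm_le _ _).trans ?_
      rw [← group_sub]
      refine (norm_group_le _ j).trans (le_of_eq ?_)
      rw [add_sub_add_left_eq_sub, ← smul_sub, norm_smul, Real.norm_of_nonneg hs, norm_sub_rev]
    have h2 := mul_le_mul_of_nonneg_left h1 (hc j)
    have h3 := mul_le_mul_of_nonneg_right (hcA j hj) (norm_nonneg (u - a))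
    nlinarith
  · simp only [group_add, group_smul, group_sub, hb j hj, ha j hj, zero_add, smul_zero, norm_zero,
      mul_zero, sub_zero]
    rw [norm_smul, Real.norm_of_nonneg hs]
    have h1 : |inner ℝ (group g j) (group u j)| ≤ C * ‖group u j‖ :=
      (abs_real_inner_le_norm _ _).trans
        (mul_le_mul_of_nonneg_right ((norm_group_le g j).trans hgC) (norm_nonneg _))
    have h2 := mul_le_mul_of_nonneg_right (hcA' j hj) (norm_nonneg (group u j))
    have h3 : 0 ≤ κ * ‖u - a‖ := by positivity
    rw [abs_le] at h1
    nlinarith [h1.1]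

end Expansion

/-! ### Consequences of the design assumption -/

section Design

variable {X : ℕ → Vec d} {Υ : Matrix (Idx d) (Idx d) ℝ}

/-- The negligibility condition needed both for the central limit theorem and for the localized
remainders. -/
lemma DesignAssumption.eventually_abs_inner_le (hX : DesignAssumption X Υ) (u : Vec d) {η : ℝ}
    (hη : 0 < η) : ∀ᶠ n : ℕ in atTop, ∀ i < n, |inner ℝ ((√(n : ℝ))⁻¹ • X i) u| ≤ η := by
  have hθ : 0 < η / (‖u‖ + 1) := by positivity
  have hev := hX.max_tendsto.eventually_lt_const (by positivity : 0 < (η / (‖u‖ + 1)) ^ 2)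
  filter_upwards [hev] with n hn i hi
  have h1 : inner ℝ (X i) (X i) ≤ ⨆ k : Fin n, inner ℝ (X k) (X k) :=
    le_ciSup (f := fun k : Fin n => inner ℝ (X k) (X k)) (Set.finite_range _).bddAbove ⟨i, hi⟩
  have h2 : ‖(√(n : ℝ))⁻¹ • X i‖ ≤ η / (‖u‖ + 1) := by
    refine le_of_sq_le_sq ?_ hθ.le
    rw [norm_smul, mul_pow, norm_inv, Real.norm_of_nonneg (Real.sqrt_nonneg _), inv_pow,
      Real.sq_sqrt (Nat.cast_nonneg n), ← real_inner_self_eq_norm_sq]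
    exact (mul_le_mul_of_nonneg_left h1 (by positivity)).trans hn.le
  calc _ ≤ ‖(√(n : ℝ))⁻¹ • X i‖ * ‖u‖ := abs_real_inner_le_norm _ _
    _ ≤ η / (‖u‖ + 1) * (‖u‖ + 1) := by gcongr; linarith
    _ = η := by field_simp

lemma DesignAssumption.tendsto_sum_inner_sq (hX : DesignAssumption X Υ) (u : Vec d) :
    Tendsto (fun n : ℕ => ∑ i ∈ Finset.range n, inner ℝ ((√(n : ℝ))⁻¹ • X i) u ^ 2) atTop
      (𝓝 (inner ℝ u (Matrix.toEuclideanCLM (𝕜 := ℝ) Υ u))) := by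
  have hcont : Continuous (fun M : Matrix (Idx d) (Idx d) ℝ => u.ofLp ⬝ᵥ M.mulVec u.ofLp) := by
    fun_prop
  have h := (hcont.tendsto Υ).comp hX.gram_tendsto
  rw [Matrix.inner_toEuclideanCLM]
  refine h.congr fun n => ?_
  simp only [Function.comp_apply]
  rw [Matrix.smul_mulVec, dotProduct_smul, Matrix.sum_mulVec, dotProduct_sum, smul_eq_mul,
    Finset.mul_sum]
  refine Finset.sum_congr rfl fun i _ => ?_
  have hi : inner ℝ (X i) u = u.ofLp ⬝ᵥ (X i).ofLp := by
    simp [PiLp.inner_apply, dotProduct]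
  rw [real_inner_smul_left, mul_pow, inv_pow, Real.sq_sqrt (Nat.cast_nonneg n),
    Matrix.vecMulVec_mulVec, hi, dotProduct_smul, dotProduct_comm (X i).ofLp]
  simp [sq]

lemma inner_toEuclideanCLM_comm {ι : Type*} [Fintype ι] [DecidableEq ι] {M : Matrix ι ι ℝ}
    (hM : M.IsHermitian) (x y : EuclideanSpace ℝ ι) :
    inner ℝ x (Matrix.toEuclideanCLM (𝕜 := ℝ) M y)
      = inner ℝ y (Matrix.toEuclideanCLM (𝕜 := ℝ) M x) := by
  have hT : M.transpose = M := by
    rw [← Matrix.conjTranspose_eq_transpose_of_trivial, hM.eq]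
  rw [Matrix.inner_toEuclideanCLM, Matrix.inner_toEuclideanCLM, Matrix.dotProduct_mulVec,
    ← Matrix.mulVec_transpose, hT, dotProduct_comm]

lemma exists_pos_mul_norm_sq_le_of_posDef {ι : Type*} [Fintype ι] [DecidableEq ι]
    {M : Matrix ι ι ℝ} (hM : M.PosDef) :
    ∃ lam > 0, ∀ x, lam * ‖x‖ ^ 2 ≤ inner ℝ x (Matrix.toEuclideanCLM (𝕜 := ℝ) M x) := by
  refine exists_pos_forall_mul_norm_sq_le _ fun x hx => ?_
  rw [Matrix.inner_toEuclideanCLM]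
  simpa using hM.dotProduct_mulVec_pos (x := x.ofLp) (by simpa using hx)

end Design

/-! ### Deterministic comparison of the estimator with the oracle -/

section Oracle

variable {A : Finset (Fin p)} {X : ℕ → Vec d} {Υ : Matrix (Idx d) (Idx d) ℝ}

/-- The linear map that sends the normalized score to the leading term of the estimator of the
relevant groups. -/
noncomputable def oracleMap (A : Finset (Fin p)) (Υ : Matrix (Idx d) (Idx d) ℝ) (c0 : ℝ) :
    Vec d →L[ℝ] EuclideanSpace ℝ (IdxOn d A) :=
  c0⁻¹ • (Matrix.toEuclideanCLM (𝕜 := ℝ) (submatrixOn A Υ)⁻¹ ∘L restrictToL A)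

lemma posDef_submatrixOn (hΥ : Υ.PosDef) : (submatrixOn A Υ).PosDef :=
  hΥ.submatrix Subtype.val_injective

lemma toEuclideanCLM_mul_inv_apply (hΥ : Υ.PosDef) (y : EuclideanSpace ℝ (IdxOn d A)) :
    Matrix.toEuclideanCLM (𝕜 := ℝ) (submatrixOn A Υ)
      (Matrix.toEuclideanCLM (𝕜 := ℝ) (submatrixOn A Υ)⁻¹ y) = y := by
  rw [← mul_apply_eq_comp, ← map_mul, Matrix.mul_nonsing_inv _
    ((Matrix.isUnit_iff_isUnit_det _).1 (posDef_submatrixOn hΥ).isUnit), map_one]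
  rfl

/-- The stationarity equation of the limiting quadratic on the relevant coordinates. -/
lemma smul_toEuclideanCLM_oracleMap (hΥ : Υ.PosDef) {c0 : ℝ} (hc0 : c0 ≠ 0) (w : Vec d) :
    c0 • Matrix.toEuclideanCLM (𝕜 := ℝ) (submatrixOn A Υ) (oracleMap A Υ c0 w)
      = restrictToL A w := by
  simp only [oracleMap, smul_apply, ContinuousLinearMap.comp_apply, map_smul]
  rw [toEuclideanCLM_mul_inv_apply hΥ, smul_smul, mul_inv_cancel₀ hc0, one_smul]

/-- The quantile estimator stays in a bounded ball at the scale `√n`. -/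
lemma norm_sqrt_smul_quantileEstimator_sub_lt (hΥ : Υ.PosDef) {τ c0 lam η C K : ℝ} (hc0 : 0 < c0)
    (hlam : ∀ x, lam * ‖x‖ ^ 2 ≤ inner ℝ x (Matrix.toEuclideanCLM (𝕜 := ℝ) Υ x)) (hK : 0 < K)
    (hlt : 2 * η + C * K < c0 / 2 * (lam * K ^ 2)) {n : ℕ} (hn : 0 < n) {e y : ℕ → ℝ}
    {b bt : Vec d} (hy : ∀ i, y i = inner ℝ (X i) b + e i)
    (hbt : IsMinOn (quantileProcess τ X y n) Set.univ bt) (hW : ‖scoreSum τ X n e‖ ≤ C)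
    (hZ : ∀ u, ‖u‖ ≤ K → |remainderSum X n e u
      - c0 / 2 * inner ℝ u (Matrix.toEuclideanCLM (𝕜 := ℝ) Υ u)| ≤ η) :
    ‖√(n : ℝ) • (bt - b)‖ < K := by
  have hsn : √(n : ℝ) ≠ 0 := (Real.sqrt_pos.2 (Nat.cast_pos.2 hn)).ne'
  have hbt' : bt = b + (√(n : ℝ))⁻¹ • (√(n : ℝ) • (bt - b)) := by
    rw [inv_smul_smul₀ hsn, add_sub_cancel]
  have hmin : quantileProcess τ X y n bt ≤ quantileProcess τ X y n (b + (√(n : ℝ))⁻¹ • 0) :=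
    hbt (Set.mem_univ _)
  rw [hbt', quantileProcess_add_smul τ X n hy, quantileProcess_add_smul τ X n hy] at hmin
  -- Centre `0` and no penalty: the linear term costs at most `C * K` on the sphere of radius `K`.
  have := norm_sub_lt_of_quadratic_approx (convexOn_remainderSum X n e)
    (convexOn_const (0 : ℝ) convex_univ) (L := Matrix.toEuclideanCLM (𝕜 := ℝ) Υ)
    (inner_toEuclideanCLM_comm hΥ.isHermitian) (η := η) (κ := C * K) (M := K) (a := 0)
    (W := scoreSum τ X n e) (u := √(n : ℝ) • (bt - b)) hc0 hlam hK (by simp) hZ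
    (fun x hx => by
      rw [sub_zero] at hx
      simp only [map_zero, smul_zero, zero_sub, sub_zero, sub_self, inner_neg_left, zero_add]
      have h1 := (le_abs_self _).trans (abs_real_inner_le_norm (scoreSum τ X n e) x)
      rw [hx] at h1
      have := mul_le_mul_of_nonneg_right hW hK.le
      linarith) hlt (by linarith)
  simpa using this

/-- On the event where the normalized score is bounded and the remainder is close to its
quadratic limit, the penalized estimator of the relevant groups is close to the oracle. -/
lemma exists_forall_norm_sub_oracleMap_lt (hΥ : Υ.PosDef) {τ γ c0 : ℝ}
    (hτ : τ ∈ Set.Ioo (0 : ℝ) 1) (hγ : 0 < γ) (hc0 : 0 < c0) {b : Vec d}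
    (hA : ∀ j, j ∈ A ↔ group b j ≠ 0) {m : ℕ → ℝ} (hm : TuningCondition m γ) {δ C : ℝ}
    (hδ : 0 < δ) (hC : 0 ≤ C) :
    ∃ η > 0, ∃ M : ℝ, ∀ᶠ n : ℕ in atTop, ∀ (e y : ℕ → ℝ) (bt bh : Vec d),
      (∀ i, y i = inner ℝ (X i) b + e i) → IsMinOn (quantileProcess τ X y n) Set.univ bt →
      IsMinOn (penalizedProcess τ γ (m n) X y n bt) Set.univ bh → ‖scoreSum τ X n e‖ ≤ C →
      (∀ u, ‖u‖ ≤ M → |remainderSum X n e u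
        - c0 / 2 * inner ℝ u (Matrix.toEuclideanCLM (𝕜 := ℝ) Υ u)| ≤ η) →
      ‖√(n : ℝ) • restrictTo A (bh - b) - oracleMap A Υ c0 (scoreSum τ X n e)‖ < δ := by
  obtain ⟨lam, hlam0, hlam⟩ := exists_pos_mul_norm_sq_le_of_posDef hΥ
  set L := Matrix.toEuclideanCLM (𝕜 := ℝ) Υ with hL
  set T := oracleMap A Υ c0 with hT
  -- Bounds the gradient `c0 • L a - w` at the oracle point `a` when the score has norm at most `C`.
  set C2 := (c0 * ‖L‖ * ‖T‖ + 1) * C with hC2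
  have hC2' : 0 ≤ C2 := by positivity
  obtain ⟨K, hK1, hK⟩ : ∃ K : ℝ, 1 ≤ K ∧ 2 * 1 + C * K < c0 / 2 * (lam * K ^ 2) := by
    refine ⟨1 + (2 + C) / (c0 / 2 * lam), by
      have : 0 ≤ (2 + C) / (c0 / 2 * lam) := by positivity
      linarith, ?_⟩
    set z := (2 + C) / (c0 / 2 * lam) with hz
    have hz0 : 0 ≤ z := by positivity
    have h1 : c0 / 2 * lam * z = 2 + C := by rw [hz]; field_simp
    have h2 : 0 < c0 / 2 * lam := by positivity
    have h3 : c0 / 2 * (lam * (1 + z) ^ 2) = (c0 / 2 * lam + c0 / 2 * lam * z) * (1 + z) := by ring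
    rw [h3, h1]
    nlinarith [mul_nonneg h2.le hz0]
  have hK0 : 0 < K := by linarith
  set θ := c0 / 2 * (lam * δ ^ 2) with hθ
  have hθ0 : 0 < θ := by positivity
  -- The budget is `θ`: two errors `η ≤ θ / 4` and a penalty slack of at most `θ / 4` leave a strict
  -- margin. The `p + 1` avoids division by zero when `p = 0`.
  set κ := θ / (4 * (p + 1) * δ) with hκ
  have hκ0 : 0 < κ := by positivity
  have hpκ : p * (κ * δ) ≤ θ / 4 := by
    rw [hκ]
    have : (p : ℝ) * (θ / (4 * (p + 1) * δ) * δ) = θ / 4 * (p / (p + 1)) := by field_simp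
    rw [this]
    refine mul_le_of_le_one_right (by positivity) ((div_le_one (by positivity)).2 (by linarith))
  refine ⟨min 1 (θ / 4), by positivity, max K (‖T‖ * C + δ), ?_⟩
  have hsqrt : Tendsto (fun n : ℕ => √(n : ℝ)) atTop atTop :=
    Real.tendsto_sqrt_atTop.comp tendsto_natCast_atTop_atTop
  have e2 : ∀ᶠ n : ℕ in atTop, ∀ j : Fin p, j ∈ A → K / √(n : ℝ) ≤ ‖group b j‖ / 2 := by
    refine eventually_all.2 fun j => ?_
    by_cases hj : j ∈ A
    · have : 0 < ‖group b j‖ / 2 := half_pos (norm_pos_iff.2 ((hA j).1 hj))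
      filter_upwards [((tendsto_const_nhds (x := K)).div_atTop hsqrt).eventually_lt_const this]
        with n hn _ using hn.le
    · exact Eventually.of_forall fun _ h => absurd h hj
  have e3 : ∀ᶠ n : ℕ in atTop, ∀ j : Fin p, m n / √(n : ℝ) * (‖group b j‖ / 2) ^ (-γ) ≤ κ := by
    refine eventually_all.2 fun j => ?_
    have := hm.div_sqrt_tendsto.mul_const ((‖group b j‖ / 2) ^ (-γ))
    rw [zero_mul] at this
    filter_upwards [this.eventually_lt_const hκ0] with n hn using hn.le
  have e4 : ∀ᶠ n : ℕ in atTop, C2 ≤ K ^ (-γ) * ((n : ℝ) ^ ((γ - 1) / 2) * m n) :=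
    (hm.rpow_mul_tendsto.const_mul_atTop (Real.rpow_pos_of_pos hK0 _)).eventually_ge_atTop C2
  filter_upwards [eventually_gt_atTop 0, hm.tendsto_atTop.eventually_gt_atTop 0, e2, e3, e4]
    with n hn hmn hn2 hn3 hn4 e y bt bh hy hbt hbh hW hZ
  have hsn : 0 < √(n : ℝ) := Real.sqrt_pos.2 (Nat.cast_pos.2 hn)
  have hinit : ‖√(n : ℝ) • (bt - b)‖ < K :=
    norm_sqrt_smul_quantileEstimator_sub_lt hΥ hc0 hlam hK0 hK hn hy hbt hW
      fun u hu => (hZ u (hu.trans (le_max_left _ _))).trans (min_le_left _ _)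
  have hinit' : ∀ j, ‖group bt j - group b j‖ ≤ K / √(n : ℝ) := by
    intro j
    rw [norm_smul, Real.norm_of_nonneg hsn.le] at hinit
    rw [le_div_iff₀ hsn, ← group_sub, mul_comm]
    exact (mul_le_mul_of_nonneg_left (norm_group_le _ j) hsn.le).trans hinit.le
  have hb0 : ∀ j ∉ A, group b j = 0 := fun j hj => not_not.1 (mt (hA j).2 hj)
  have hbtA : ∀ j ∈ A, ‖group b j‖ / 2 ≤ ‖group bt j‖ := by
    intro j hj
    have h1 := hinit' j
    have h2 := hn2 j hj
    have h3 := norm_sub_norm_le (group b j) (group bt j)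
    rw [norm_sub_rev] at h3
    linarith
  have hbtA0 : ∀ j ∈ A, group bt j ≠ 0 := fun j hj h0 => by
    have h1 := hbtA j hj
    have h2 := norm_pos_iff.2 ((hA j).1 hj)
    rw [h0, norm_zero] at h1
    linarith
  set w := scoreSum τ X n e with hw
  set a : Vec d := extendByZero (T w) with ha
  have ha0 : ∀ j ∉ A, group a j = 0 := fun j hj => group_extendByZero _ hj
  have hTw : ‖T w‖ ≤ ‖T‖ * C := (T.le_opNorm w).trans (by gcongr)
  have hanorm : ‖a‖ ≤ ‖T‖ * C := by rw [ha, norm_extendByZero]; exact hTw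
  set g : Vec d := c0 • L a - w with hg
  have hgA : ∀ j ∈ A, group g j = 0 := by
    refine fun j hj => group_eq_zero_of_restrictToL_eq_zero (A := A) ?_ hj
    rw [hg, map_sub, map_smul, ha, restrictToL_toEuclideanCLM_extendByZero,
      smul_toEuclideanCLM_oracleMap hΥ hc0.ne', sub_self]
  have hgC : ‖g‖ ≤ C2 := by
    calc ‖g‖ ≤ ‖c0 • L a‖ + ‖w‖ := norm_sub_le _ _
      _ ≤ c0 * (‖L‖ * (‖T‖ * C)) + C := by
        rw [norm_smul, Real.norm_of_nonneg hc0.le]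
        gcongr
        exact (L.le_opNorm a).trans (by gcongr)
      _ = C2 := by rw [hC2]; ring
  -- An infinite weight is replaced by the finite one whose slope in the local scale is exactly
  -- `C2`.
  set c : Fin p → ℝ := fun j =>
    if group bt j = 0 then C2 * √(n : ℝ) else m n * ‖group bt j‖ ^ (-γ) with hc
  have hc0' : ∀ j, 0 ≤ c j := by
    intro j
    simp only [hc]
    split_ifs <;> positivity
  have hcA : ∀ j ∈ A, c j * (√(n : ℝ))⁻¹ ≤ κ := by
    intro j hj
    refine le_trans ?_ (hn3 j)
    simp only [hc, if_neg (hbtA0 j hj)]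
    have h1 : ‖group bt j‖ ^ (-γ) ≤ (‖group b j‖ / 2) ^ (-γ) :=
      Real.rpow_le_rpow_of_nonpos (half_pos (norm_pos_iff.2 ((hA j).1 hj))) (hbtA j hj)
        (by linarith)
    calc _ = m n / √(n : ℝ) * ‖group bt j‖ ^ (-γ) := by ring
      _ ≤ _ := by gcongr
  have hcA' : ∀ j ∉ A, C2 ≤ c j * (√(n : ℝ))⁻¹ := by
    intro j hj
    by_cases h0 : group bt j = 0
    · simp only [hc, if_pos h0]
      rw [mul_assoc, mul_inv_cancel₀ hsn.ne', mul_one]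
    · refine hn4.trans ?_
      simp only [hc, if_neg h0]
      have h1 : ‖group bt j‖ ≤ K / √(n : ℝ) := by
        have := hinit' j
        rwa [hb0 j hj, sub_zero] at this
      have h2 : (K / √(n : ℝ)) ^ (-γ) ≤ ‖group bt j‖ ^ (-γ) :=
        Real.rpow_le_rpow_of_nonpos (norm_pos_iff.2 h0) h1 (by linarith)
      -- The weight contributes `n ^ (γ / 2)` and the local scaling `n ^ (-1 / 2)`, whence the
      -- exponent in the tuning condition.
      have h3 : (K / √(n : ℝ)) ^ (-γ) * (√(n : ℝ))⁻¹ = K ^ (-γ) * (n : ℝ) ^ ((γ - 1) / 2) := by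
        have hn' : (0 : ℝ) < n := Nat.cast_pos.2 hn
        rw [Real.div_rpow hK0.le hsn.le, Real.rpow_neg hsn.le, div_inv_eq_mul, mul_assoc]
        congr 1
        rw [Real.sqrt_eq_rpow, ← Real.rpow_mul hn'.le, ← Real.rpow_neg hn'.le,
          ← Real.rpow_add hn']
        congr 1
        ring
      calc K ^ (-γ) * ((n : ℝ) ^ ((γ - 1) / 2) * m n)
          = m n * ((K / √(n : ℝ)) ^ (-γ) * (√(n : ℝ))⁻¹) := by rw [h3]; ring
        _ ≤ m n * (‖group bt j‖ ^ (-γ) * (√(n : ℝ))⁻¹) := by gcongr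
        _ = _ := by ring
  set u : Vec d := √(n : ℝ) • (bh - b) with hu
  have hbh' : bh = b + (√(n : ℝ))⁻¹ • u := by
    rw [hu, inv_smul_smul₀ hsn.ne', add_sub_cancel]
  -- The oracle point is an admissible competitor: groups where `bt` vanishes are irrelevant, and
  -- there both `b` and `a` are zero.
  have hle := realPenalized_le_of_penalizedProcess_le hτ hγ hmn (X := X) (y := y) (n := n)
    (bInit := bt) (b := bh) (b' := b + (√(n : ℝ))⁻¹ • a) (C2 * √(n : ℝ)) (by positivity)
    (fun j hj => by
      have hjA : j ∉ A := fun h => hbtA0 j h hj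
      rw [group_add, group_smul, hb0 j hjA, ha0 j hjA, smul_zero, add_zero])
    (hbh (Set.mem_univ _))
  rw [hbh'] at hle
  simp only [quantileProcess_add_smul τ X n hy] at hle
  have hclose : ‖u - a‖ < δ := by
    refine norm_sub_lt_of_quadratic_approx (convexOn_remainderSum X n e)
      (convexOn_penalty c hc0' b (√(n : ℝ))⁻¹) (L := L)
      (inner_toEuclideanCLM_comm hΥ.isHermitian) (η := min 1 (θ / 4)) (κ := p * (κ * δ))
      (M := max K (‖T‖ * C + δ)) (W := w) hc0 hlam hδ
      (le_trans (by linarith) (le_max_right _ _)) hZ (fun x hx => ?_) ?_ ?_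
    · have := penalty_sub_add_inner_ge hc0' (inv_nonneg.2 hsn.le) hcA hcA' hκ0.le hb0 ha0 hgA
        hgC x
      rwa [hx] at this
    · have := min_le_right 1 (θ / 4)
      linarith
    · linarith
  have hfin : √(n : ℝ) • restrictTo A (bh - b) - T w = restrictToL A (u - a) := by
    rw [map_sub, ha, restrictToL_extendByZero, hu, map_smul, restrictToL_apply]
  have hle1 : ‖restrictToL A (u - a)‖ ≤ ‖u - a‖ := by
    have h1 := inner_extendByZero (u - a) (restrictToL A (u - a))
    rw [real_inner_self_eq_norm_sq] at h1
    have h2 := real_inner_le_norm (u - a) (extendByZero (restrictToL A (u - a)))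
    rw [norm_extendByZero, h1] at h2
    by_contra! hlt
    nlinarith [norm_nonneg (u - a)]
  rw [hfin]
  exact hle1.trans_lt hclose

end Oracle

end

/-! ### Tightness, the central limit theorem and the conclusion -/

section

variable {p : ℕ} {d : Fin p → ℕ} {A : Finset (Fin p)} {X : ℕ → Vec d}
  {Υ : Matrix (Idx d) (Idx d) ℝ} {Ω : Type*} [MeasurableSpace Ω] {P : Measure Ω}
  {ε : ℕ → Ω → ℝ} {ν : Measure ℝ}

/-- By convexity, the Knight remainders converge in probability uniformly on balls. -/
lemma tendsto_measure_not_uniformly_close [IsProbabilityMeasure P]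
    [IsProbabilityMeasure ν] (hX : DesignAssumption X Υ) (hind : iIndepFun ε P)
    (hlaw : ∀ i, HasLaw (ε i) ν P) {c0 : ℝ} (hν : ∀ η > 0, ∃ δ > 0, ∀ h, |h| ≤ δ →
      |∫ x, knightRemainder x h ∂ν - c0 / 2 * h ^ 2| ≤ η * h ^ 2) (M : ℝ) {η : ℝ} (hη : 0 < η) :
    Tendsto (fun n : ℕ => P {ω | ¬ ∀ u, ‖u‖ ≤ M → |remainderSum X n (fun i => ε i ω) u
      - c0 / 2 * inner ℝ u (Matrix.toEuclideanCLM (𝕜 := ℝ) Υ u)| ≤ η}) atTop (𝓝 0) := by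
  have hq : Continuous (fun u : Vec d =>
      c0 / 2 * inner ℝ u (Matrix.toEuclideanCLM (𝕜 := ℝ) Υ u)) := by fun_prop
  obtain ⟨S, δ, hδ, hS⟩ := exists_finset_forall_convexOn_of_isCompact hq
    (isCompact_closedBall (0 : Vec d) M) hη
  have hsum : Tendsto (fun n : ℕ => ∑ s ∈ S, P {ω | δ ≤ |remainderSum X n (fun i => ε i ω) s
      - c0 / 2 * inner ℝ s (Matrix.toEuclideanCLM (𝕜 := ℝ) Υ s)|}) atTop (𝓝 0) := by
    have h0 : (0 : ENNReal) = ∑ _s ∈ S, 0 := by simp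
    refine h0 ▸ tendsto_finsetSum _ fun s _ => tendsto_measure_sum_knightRemainder hind hlaw hν
      (fun η hη => hX.eventually_abs_inner_le s hη) (hX.tendsto_sum_inner_sq s) hδ
  refine tendsto_of_tendsto_of_tendsto_of_le_of_le tendsto_const_nhds hsum (fun _ => zero_le)
    fun n => ?_
  refine le_trans (measure_mono fun ω hω => ?_) (measure_biUnion_finset_le S _)
  by_contra hc
  simp only [Set.mem_iUnion, not_exists, Set.mem_ofPred_eq, not_le] at hc
  exact hω fun u hu => hS _ (convexOn_remainderSum X n _) (fun s hs => (hc s hs).le) u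
    (by simpa using hu)

lemma aemeasurable_scoreSum (hlaw : ∀ i, HasLaw (ε i) ν P) (τ : ℝ) (X : ℕ → Vec d) (n : ℕ) :
    AEMeasurable (fun ω => scoreSum τ X n fun i => ε i ω) P :=
  Finset.aemeasurable_fun_sum _ fun i _ =>
    ((measurable_score τ).comp_aemeasurable (hlaw i).aemeasurable).smul_const _

lemma tendsto_charFun_scoreSum [IsProbabilityMeasure ν] (hX : DesignAssumption X Υ)
    (hind : iIndepFun ε P)
    (hlaw : ∀ i, HasLaw (ε i) ν P) {τ : ℝ} (hτ : τ ∈ Set.Ioo (0 : ℝ) 1)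
    (hν : ν.real (Set.Iio 0) = τ) (t : Vec d) :
    Tendsto (fun n : ℕ => charFun (P.map fun ω => scoreSum τ X n fun i => ε i ω) t) atTop
      (𝓝 (Complex.exp ((-(τ * (1 - τ)
        * inner ℝ t (Matrix.toEuclideanCLM (𝕜 := ℝ) Υ t) / 2) : ℝ)))) := by
  simp only [scoreSum, charFun_map_sum_score_smul hind hlaw hν]
  exact tendsto_prod_scoreCharFun hτ (fun η hη => hX.eventually_abs_inner_le t hη)
    (hX.tendsto_sum_inner_sq t)

/-- Tightness follows because the characteristic functions converge to a function continuous at `0`.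
-/
lemma exists_forall_measure_norm_scoreSum_le [IsProbabilityMeasure P]
    [IsProbabilityMeasure ν] (hX : DesignAssumption X Υ) (hind : iIndepFun ε P)
    (hlaw : ∀ i, HasLaw (ε i) ν P) {τ : ℝ} (hτ : τ ∈ Set.Ioo (0 : ℝ) 1)
    (hν : ν.real (Set.Iio 0) = τ) {κ : ENNReal} (hκ : 0 < κ) :
    ∃ C, 0 ≤ C ∧ ∀ n, P {ω | ¬ ‖scoreSum τ X n fun i => ε i ω‖ ≤ C} ≤ κ := by
  have hm := aemeasurable_scoreSum hlaw τ X
  have hp : ∀ n, IsProbabilityMeasure (P.map fun ω => scoreSum τ X n fun i => ε i ω) := fun n =>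
    Measure.isProbabilityMeasure_map (hm n)
  have htight := isTightMeasureSet_of_tendsto_charFun (f := fun t : Vec d =>
    Complex.exp ((-(τ * (1 - τ) * inner ℝ t (Matrix.toEuclideanCLM (𝕜 := ℝ) Υ t) / 2) : ℝ)))
    (by fun_prop) (tendsto_charFun_scoreSum hX hind hlaw hτ hν)
  obtain ⟨K, hK, hKle⟩ := isTightMeasureSet_iff_exists_isCompact_measure_compl_le.1 htight κ hκ
  obtain ⟨C, hC⟩ := hK.isBounded.exists_norm_le
  refine ⟨max C 0, le_max_right _ _, fun n => le_trans ?_ (hKle _ ⟨n, rfl⟩)⟩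
  rw [Measure.map_apply_of_aemeasurable (hm n) hK.isClosed.measurableSet.compl]
  exact measure_mono fun ω hω hmem => hω ((hC _ hmem).trans (le_max_left _ _))

lemma inner_oracleMap (hΥ : Υ.PosDef) (c0 : ℝ) (w : Vec d) (t : EuclideanSpace ℝ (IdxOn d A)) :
    inner ℝ (oracleMap A Υ c0 w) t = inner ℝ w
      (c0⁻¹ • extendByZero (Matrix.toEuclideanCLM (𝕜 := ℝ) (submatrixOn A Υ)⁻¹ t)) := by
  simp only [oracleMap, smul_apply, ContinuousLinearMap.comp_apply]
  rw [real_inner_smul_left, inner_smul_right, inner_extendByZero, real_inner_comm,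
    inner_toEuclideanCLM_comm (posDef_submatrixOn hΥ).inv.isHermitian]

/-- The central limit theorem for the leading term. -/
lemma tendstoInDistribution_oracleMap_scoreSum [IsProbabilityMeasure P]
    [IsProbabilityMeasure ν] (hX : DesignAssumption X Υ)
    (hind : iIndepFun ε P) (hlaw : ∀ i, HasLaw (ε i) ν P) {τ : ℝ} (hτ : τ ∈ Set.Ioo (0 : ℝ) 1)
    (hν : ν.real (Set.Iio 0) = τ) (c0 : ℝ) :
    TendstoInDistribution (fun (n : ℕ) ω => oracleMap A Υ c0 (scoreSum τ X n fun i => ε i ω))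
      atTop id (fun _ => P)
      (multivariateGaussian 0 ((τ * (1 - τ) * c0 ^ (-2 : ℤ)) • (submatrixOn A Υ)⁻¹)) := by
  have hm := aemeasurable_scoreSum hlaw τ X
  have hΥA : (submatrixOn A Υ).PosDef := posDef_submatrixOn hX.posDef
  set D := Matrix.toEuclideanCLM (𝕜 := ℝ) (submatrixOn A Υ)⁻¹ with hD
  have hpsd : ((τ * (1 - τ) * c0 ^ (-2 : ℤ)) • (submatrixOn A Υ)⁻¹).PosSemidef := by
    refine hΥA.inv.posSemidef.smul (mul_nonneg (mul_nonneg hτ.1.le (sub_nonneg.2 hτ.2.le)) ?_)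
    rw [zpow_neg]
    exact inv_nonneg.2 (by positivity)
  refine ⟨fun n => (oracleMap A Υ c0).continuous.measurable.comp_aemeasurable (hm n),
    aemeasurable_id, ProbabilityMeasure.tendsto_of_tendsto_charFun fun t => ?_⟩
  simp only [ProbabilityMeasure.coe_mk, Measure.map_id]
  rw [charFun_multivariateGaussian hpsd]
  have hchar : ∀ n, charFun (P.map fun ω => oracleMap A Υ c0 (scoreSum τ X n fun i => ε i ω)) t
      = charFun (P.map fun ω => scoreSum τ X n fun i => ε i ω) (c0⁻¹ • extendByZero (D t)) := by
    intro n
    have hsum : (fun ω => oracleMap A Υ c0 (scoreSum τ X n fun i => ε i ω))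
        = fun ω => ∑ i ∈ Finset.range n,
          score τ (ε i ω) • oracleMap A Υ c0 ((√(n : ℝ))⁻¹ • X i) := by
      ext1 ω
      rw [scoreSum, map_sum]
      exact Finset.sum_congr rfl fun i _ => map_smul _ _ _
    rw [hsum]
    simp only [scoreSum]
    rw [charFun_map_sum_score_smul hind hlaw hν, charFun_map_sum_score_smul hind hlaw hν]
    exact Finset.prod_congr rfl fun i _ => by rw [inner_oracleMap hX.posDef]
  simp_rw [hchar]
  convert tendsto_charFun_scoreSum hX hind hlaw hτ hν (c0⁻¹ • extendByZero (D t)) using 3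
  -- With `D` the inverse of `Υ_A`, the limiting quadratic form at the extension of `D t` is `⟨D t,
  -- Υ_A D t⟩ = ⟨t, D t⟩`; the two factors `c0⁻¹` give the exponent `-2`.
  rw [inner_zero_right, map_smul, inner_smul_right, real_inner_smul_left, real_inner_comm,
    inner_extendByZero, restrictToL_toEuclideanCLM_extendByZero, toEuclideanCLM_mul_inv_apply hX.posDef, hD,
    Matrix.inner_toEuclideanCLM, Matrix.smul_mulVec, dotProduct_smul, zpow_neg]
  simp only [smul_eq_mul, zpow_ofNat]
  push_cast
  ring

/-- Asymptotic normality of the adaptive group LASSO quantile estimator of the relevant groups. -/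
theorem tendstoInDistribution_adaptiveGroupLasso [IsProbabilityMeasure P] (b : Vec d)
    (hA : ∀ j, j ∈ A ↔ group b j ≠ 0) (Y : ℕ → Ω → ℝ)
    (hY : ∀ i ω, Y i ω = inner ℝ (X i) b + ε i ω) {τ : ℝ} (hτ : τ ∈ Set.Ioo (0 : ℝ) 1)
    [IsProbabilityMeasure ν] {f : ℝ → ℝ} {B : Set ℝ} (hX : DesignAssumption X Υ)
    (hε : ErrorAssumption P τ X Υ ε ν f B) {m : ℕ → ℝ} {γ : ℝ} (hγ : 0 < γ)
    (hm : TuningCondition m γ) (bt : ℕ → Ω → Vec d)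
    (hbt : ∀ n ω, IsMinOn (quantileProcess τ X (fun i => Y i ω) n) Set.univ (bt n ω))
    (bh : ℕ → Ω → Vec d) (hbh_meas : ∀ n, Measurable (bh n))
    (hbh : ∀ n ω, IsMinOn (penalizedProcess τ γ (m n) X (fun i => Y i ω) n (bt n ω))
      Set.univ (bh n ω)) :
    TendstoInDistribution (fun (n : ℕ) ω => √(n : ℝ) • restrictTo A (bh n ω - b)) atTop
      id (fun _ => P)
      (multivariateGaussian 0 ((τ * (1 - τ) * (f 0) ^ (-2 : ℤ)) • (submatrixOn A Υ)⁻¹)) := by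
  obtain ⟨U, hU, h0, hf, hpos, hν⟩ := hε.density
  have hIio := measureReal_Iio_zero_of_density h0 hν hε.quantile
  have hR := fun (η : ℝ) (hη : 0 < η) =>
    exists_forall_abs_integral_knightRemainder_sub_le hU h0 hf hpos hν hη
  refine tendstoInDistribution_of_tendstoInMeasure_sub _ _
    (tendstoInDistribution_oracleMap_scoreSum (A := A) hX hε.indep hε.law hτ hIio (f 0)) ?_
    fun n => ?_
  · refine tendstoInMeasure_iff_norm.2 fun δ hδ => ENNReal.tendsto_nhds_zero.2 fun κ hκ => ?_
    obtain ⟨C, hC, hCP⟩ := exists_forall_measure_norm_scoreSum_le hX hε.indep hε.law hτ hIio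
      (ENNReal.half_pos hκ.ne')
    obtain ⟨η, hη, M, hM⟩ := exists_forall_norm_sub_oracleMap_lt (A := A) (X := X) hX.posDef hτ hγ
      (hpos 0 h0) hA hm hδ hC
    have hZ := ENNReal.tendsto_nhds_zero.1
      (tendsto_measure_not_uniformly_close hX hε.indep hε.law hR M hη) (κ / 2)
      (ENNReal.half_pos hκ.ne')
    filter_upwards [hM, hZ] with n hn hZn
    -- A deviation of size `δ` requires either a large score or a failure of the uniform
    -- approximation, each of probability at most `κ / 2`.
    refine le_trans (measure_mono fun ω hω => ?_) ((measure_union_le _ _).trans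
      ((add_le_add (hCP n) hZn).trans_eq (ENNReal.add_halves κ)))
    by_contra hc
    obtain ⟨h1, h2⟩ := not_or.1 hc
    have := hn (fun i => ε i ω) (fun i => Y i ω) (bt n ω) (bh n ω) (fun i => hY i ω) (hbt n ω)
      (hbh n ω) (not_not.1 h1) (not_not.1 h2)
    simp only [Set.mem_ofPred_eq, Pi.sub_apply, Pi.zero_apply, sub_zero] at hω
    exact absurd hω (not_le.2 this)
  · exact (((restrictToL A).continuous.measurable.comp
      ((hbh_meas n).sub_const b)).const_smul (√(n : ℝ))).aemeasurable

end

end GroupLassoQuantile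

theorem theorem1 {Ω : Type*} [MeasurableSpace Ω] (P : Measure Ω) [IsProbabilityMeasure P]
    -- `p` groups, of sizes `d j`; the true parameter `β0`, with the set `A` of relevant groups
    {p : ℕ} {d : Fin p → ℕ} (β0 : GroupLassoQuantile.Vec d)
    (A : Finset (Fin p)) (hA : ∀ j, j ∈ A ↔ GroupLassoQuantile.group β0 j ≠ 0)
    -- the linear model; observation `i + 1` has index `i`
    (X : ℕ → GroupLassoQuantile.Vec d) (ε Y : ℕ → Ω → ℝ)
    (hY : ∀ i ω, Y i ω = inner ℝ (X i) β0 + ε i ω)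
    (τ : ℝ) (hτ : τ ∈ Set.Ioo (0 : ℝ) 1)
    (Υ : Matrix (GroupLassoQuantile.Idx d) (GroupLassoQuantile.Idx d) ℝ)
    (ν : Measure ℝ) [IsProbabilityMeasure ν] (f : ℝ → ℝ) (B : Set ℝ)
    (hX : GroupLassoQuantile.DesignAssumption X Υ)
    (hε : GroupLassoQuantile.ErrorAssumption P τ X Υ ε ν f B)
    -- the tuning parameters
    (μ : ℕ → ℝ) (hμ : ∀ n, 0 ≤ μ n) (γ : ℝ) (hγ : 0 < γ)
    (hμγ : GroupLassoQuantile.TuningCondition μ γ)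
    -- the quantile estimator
    (βtilde : ℕ → Ω → GroupLassoQuantile.Vec d) (hβtilde_meas : ∀ n, Measurable (βtilde n))
    (hβtilde : ∀ n ω, IsMinOn
      (GroupLassoQuantile.quantileProcess τ X (fun i => Y i ω) n) Set.univ (βtilde n ω))
    -- the adaptive group LASSO quantile estimator
    (βhat : ℕ → Ω → GroupLassoQuantile.Vec d) (hβhat_meas : ∀ n, Measurable (βhat n))
    (hβhat : ∀ n ω, IsMinOn
      (GroupLassoQuantile.penalizedProcess τ γ (μ n) X (fun i => Y i ω) n (βtilde n ω))
      Set.univ (βhat n ω)) :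
    TendstoInDistribution
      (fun (n : ℕ) ω => √(n : ℝ) • GroupLassoQuantile.restrictTo A (βhat n ω - β0)) atTop
      id (fun _ => P)
      (multivariateGaussian 0
        ((τ * (1 - τ) * (f 0) ^ (-2 : ℤ)) • (GroupLassoQuantile.submatrixOn A Υ)⁻¹)) :=
  GroupLassoQuantile.tendstoInDistribution_adaptiveGroupLasso β0 hA Y hY hτ hX hε hγ hμγ βtilde
    hβtilde βhat hβhat_meas hβhat
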